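/- **Setting.** Let $d\in\mathbb N$ and $T\in(0,\infty]$, and put $\mathcal O_T=(0,T)\times\mathbb R^d$. For $X=(t,x)$ and $Y=(s,y)$ in $\mathbb R\times\mathbb R^d$ let $\delta(X,Y)=\max\{|x-y|,|t-s|^{1/2}\}$ and $Q_\rho(X)=\{Y:\delta(X,Y)<\rho\}$. Write $|\cdot|$ for Lebesgue measure of sets and $\operatorname{diam}$ for the diameter with respect to $\delta$. A bounded domain $D\subset\mathbb R^{d+1}$ is of $A$-type, with constant $A>0$, if $|D\cap Q_\rho(X)|\ge A\,|Q_\rho(X)|$ for all $X\in D$ and $0<\rho\le\operatorname{diam}D$. For $p\ge1$, $\theta\ge0$ and a measurable random field $h$, put $$[h]^p_{\mathscr L^{p,\theta}((D;\delta);L^p(\Omega))}=\sup_{X\in D,\ 0<\rho\le \operatorname{diam}D}\frac1{|Q|^{1+\theta}}\,\mathbb E\int_Q\int_Q|h(Y)-h(Z)|^p\,dZ\,dY,\qquad Q=D\cap Q_\rho(X).$$ Let $W$ be a one-dimensional Brownian motion. For a (non-random) measurable kernel $K:\mathbb R\times\mathbb R^d\to\mathbb R$ and a (non-random) $g:\mathbb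 R^d\to\mathbb R$, set $$\mathcal Kg(t,x)=\int_0^t\int_{\mathbb R^d}K(t-r,y)\,g(x-y)\,dy\,dW(r).$$ **Theorem.** Let $0<\beta<1$ and let $g\in C^\beta$ be independent of time with $g(0)=0$, i.e. $|g(x)-g(y)|\le C_g|x-y|^\beta$ for all $x,y\in\mathbb R^d$. Assume that there are $\gamma_1,\gamma_2>0$ and constants $N_0,N_1\ge 0$ such that for all $0\le s<t\le T$, $t<\infty$, $$\int_0^s\Big(\int_{\mathbb R^d}|K(t-r,z)-K(s-r,z)|(1+|z|^\beta)\,dz\Big)^2dr\le N_1(t-s)^{\gamma_1},$$ $$\int_0^s\Big(\int_{\mathbb R^d}|K(s-r,z)|\,dz\Big)^2dr\le N_0,$$ $$\int_s^t\Big(\int_{\mathbb R^d}|K(t-r,z)|(1+|z|^\beta)\,dz\Big)^2dr\le N_1(t-s)^{\gamma_2}.$$ Then $\mathcal Kg$ is well defined on $\mathcal O_T$ and has a jointly measurable version there. Moreover, let $D$ be an $A$-type bounded domain with constant $A$, with $\overline D\subset\mathcal O_T$ and $|t|\le R$, $|x|\le R$ for all $(t,x)\in D$. Then for every $p\ge1$,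 with $\gamma=\min\{\gamma_1,\gamma_2,\beta\}$ and $\theta=1+\frac{\gamma p}{d+2}$, every jointly measurable version of $\mathcal Kg$ satisfies $$[\mathcal Kg]_{\mathscr L^{p,\theta}((D;\delta);L^p(\Omega))}\le N,$$ where the finite constant $N$ depends only on $d,T,p,\beta,\gamma_1,\gamma_2,N_0,N_1,C_g,A,R$. -/

import Mathlib

open MeasureTheory ProbabilityTheory Set Filter Topology
open scoped ENNReal NNReal

noncomputable section

/-- Space-time `ℝ × ℝ^d`; a point is `X = (t, x)`. -/
abbrev SpaceTime (d : ℕ) : Type := ℝ × EuclideanSpace ℝ (Fin d)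

/-- The parabolic distance `δ(X, Y) = max {|x - y|, |t - s|^{1/2}}`. -/
def parabolicDist {d : ℕ} (X Y : SpaceTime d) : ℝ :=
  max ‖X.2 - Y.2‖ (|X.1 - Y.1| ^ (1 / 2 : ℝ))

/-- The parabolic ball `Q_c(X)`, that is `(t - c², t + c²) × B_c(x)` for `c > 0`. -/
def parabolicBall {d : ℕ} (X : SpaceTime d) (c : ℝ) : Set (SpaceTime d) :=
  {Y | parabolicDist X Y < c}

/-- The diameter of `D` with respect to the parabolic distance, as an extended real. -/
def parabolicDiam {d : ℕ} (D : Set (SpaceTime d)) : ℝ≥0∞ :=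
  ⨆ X ∈ D, ⨆ Y ∈ D, ENNReal.ofReal (parabolicDist X Y)

/-- The strip `𝒪_T = (0, T) × ℝ^d`, where `T = ∞` is allowed. -/
def timeStrip (d : ℕ) (T : EReal) : Set (SpaceTime d) :=
  {X | 0 < X.1 ∧ (X.1 : EReal) < T}

/-- `D` is of `A`-type with constant `A`:
`|D ∩ Q_ρ(X)| ≥ A |Q_ρ(X)|` for all `X ∈ D` and `0 < ρ ≤ diam D`. -/
def IsATypeWith {d : ℕ} (A : ℝ≥0) (D : Set (SpaceTime d)) : Prop :=
  ∀ X ∈ D, ∀ ρ : ℝ, 0 < ρ → ENNReal.ofReal ρ ≤ parabolicDiam D →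
    (A : ℝ≥0∞) * volume (parabolicBall X ρ) ≤ volume (D ∩ parabolicBall X ρ)

/-- The expected oscillation `𝔼 ∫_Q ∫_Q |h(Y) - h(Z)|^p dZ dY` of a random field `h` over `Q`. -/
def expectedOscillation {d : ℕ} {Ω : Type*} [MeasurableSpace Ω] (P : Measure Ω) (p : ℝ)
    (Q : Set (SpaceTime d)) (h : SpaceTime d → Ω → ℝ) : ℝ≥0∞ :=
  ∫⁻ ω, (∫⁻ Y in Q, (∫⁻ Z in Q, ‖h Y ω - h Z ω‖ₑ ^ p ∂volume) ∂volume) ∂P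

/-- The stochastic Campanato seminorm of a random field `h` on `D`: the `p`-th root of the supremum,
over the sets `Q = D ∩ Q_ρ(X)` with `X ∈ D` and `0 < ρ ≤ diam D`, of
`|Q|^{-(1+θ)} 𝔼 ∫_Q ∫_Q |h(Y) - h(Z)|^p dZ dY`. -/
def stochCampanatoSeminorm {d : ℕ} {Ω : Type*} [MeasurableSpace Ω] (P : Measure Ω) (p θ : ℝ)
    (D : Set (SpaceTime d)) (h : SpaceTime d → Ω → ℝ) : ℝ≥0∞ :=
  (⨆ X ∈ D, ⨆ ρ : ℝ, ⨆ _ : 0 < ρ ∧ ENNReal.ofReal ρ ≤ parabolicDiam D,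
    expectedOscillation P p (D ∩ parabolicBall X ρ) h /
      volume (D ∩ parabolicBall X ρ) ^ (1 + θ)) ^ (1 / p)

/-- A (deterministic) step function on `(0, t]`: a finite linear combination of indicators of
intervals `(a_i, b_i]` contained in `(0, t]`. -/
structure TimeStepFun (t : ℝ≥0) where
  n : ℕ
  coeff : Fin n → ℝ
  left : Fin n → ℝ≥0
  right : Fin n → ℝ≥0
  left_le_right : ∀ i, left i ≤ right i
  right_le : ∀ i, right i ≤ t

/-- The step function `∑ c_i 1_{(a_i, b_i]}`. -/
def TimeStepFun.eval {t : ℝ≥0} (φ : TimeStepFun t) (r : ℝ) : ℝ :=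
  ∑ i, φ.coeff i * (Ioc (φ.left i : ℝ) (φ.right i : ℝ)).indicator (fun _ => (1 : ℝ)) r

/-- The elementary stochastic integral `∑ c_i (W(b_i) - W(a_i))`. -/
def TimeStepFun.integral {t : ℝ≥0} (φ : TimeStepFun t) {Ω : Type*} (W : ℝ≥0 → Ω → ℝ) (ω : Ω) : ℝ :=
  ∑ i, φ.coeff i * (W (φ.right i) ω - W (φ.left i) ω)

/-- `J` is (a version of) the stochastic integral `∫_0^t f(r) dW(r)` of the deterministic function
`f ∈ L²(0, t)`: the limit in `L²(Ω)` of the elementary integrals of step functions that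
converge to `f` in `L²(0, t)`. -/
def IsWienerIntegral {Ω : Type*} [MeasurableSpace Ω] (P : Measure Ω) (W : ℝ≥0 → Ω → ℝ)
    (t : ℝ≥0) (f : ℝ → ℝ) (J : Ω → ℝ) : Prop :=
  MemLp f 2 (volume.restrict (Ioc 0 (t : ℝ))) ∧ MemLp J 2 P ∧
    ∃ φ : ℕ → TimeStepFun t,
      Tendsto (fun k => eLpNorm (fun r => (φ k).eval r - f r) 2 (volume.restrict (Ioc 0 (t : ℝ))))
        atTop (𝓝 0) ∧
      Tendsto (fun k => eLpNorm (fun ω => (φ k).integral W ω - J ω) 2 P) atTop (𝓝 0)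

/-- `u` is (a version of) the stochastic convolution
`𝒦g(t, x) = ∫_0^t ∫_{ℝ^d} K(t - r, y) g(x - y) dy dW(r)` at all points `(t, x)` of `S`. -/
def IsStochConvolutionOn {d : ℕ} {Ω : Type*} [MeasurableSpace Ω] (P : Measure Ω)
    (W : ℝ≥0 → Ω → ℝ) (K : ℝ → EuclideanSpace ℝ (Fin d) → ℝ) (g : EuclideanSpace ℝ (Fin d) → ℝ)
    (S : Set (SpaceTime d)) (u : SpaceTime d → Ω → ℝ) : Prop :=
  ∀ X ∈ S, IsWienerIntegral P W X.1.toNNReal (fun r => ∫ y, K (X.1 - r) y * g (X.2 - y)) (u X)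

/-- The integral conditions on the kernel `K`, for all times `0 ≤ s < t ≤ T`, `t < ∞`. -/
structure KernelConditions {d : ℕ} (K : ℝ → EuclideanSpace ℝ (Fin d) → ℝ) (T : EReal)
    (β : ℝ) (γ₁ γ₂ : ℝ) (N₀ N₁ : ℝ≥0) : Prop where
  measurable : Measurable (Function.uncurry K)
  time_increment : ∀ s t : ℝ, 0 ≤ s → s < t → (t : EReal) ≤ T →
    ∫⁻ r in Ioc 0 s, (∫⁻ z, ‖K (t - r) z - K (s - r) z‖ₑ * ENNReal.ofReal (1 + ‖z‖ ^ β)) ^ 2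
      ≤ N₁ * ENNReal.ofReal ((t - s) ^ γ₁)
  mass : ∀ s t : ℝ, 0 ≤ s → s < t → (t : EReal) ≤ T →
    ∫⁻ r in Ioc 0 s, (∫⁻ z, ‖K (s - r) z‖ₑ) ^ 2 ≤ N₀
  short_time : ∀ s t : ℝ, 0 ≤ s → s < t → (t : EReal) ≤ T →
    ∫⁻ r in Ioc s t, (∫⁻ z, ‖K (t - r) z‖ₑ * ENNReal.ofReal (1 + ‖z‖ ^ β)) ^ 2
      ≤ N₁ * ENNReal.ofReal ((t - s) ^ γ₂)

end

/-!
By the Itô isometry and Gaussianity, the `L^q(Ω)` norm of a Wiener integral is the `L²` norm of its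
integrand times the `L^q` norm of a standard normal variable. The kernel conditions bound the `L²`
norm of the increments of the integrand `r ↦ (K(t - r, ·) * g)(x)`. Hence `𝒦g`, as a map from a
bounded part of the strip with the parabolic distance to `L^q(Ω)`, is Hölder continuous of order
`γ = min {γ₁, γ₂, β}`. For `q = 2` this continuity lets `𝒦g` be approximated by countably valued
`L²(Ω)`-valued maps, fast enough to converge almost surely at each point, and the limit is a jointly
measurable version. For `q = p`, the expected oscillation over `Q = D ∩ Q_ρ(X)` is at most a
constant times `ρ^{γ p} |Q|²`, and the `A`-type bound `ρ^{d+2} ≲ |Q|` turns the power of `ρ` into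
one of `|Q|`.
-/

/-! ### Elementary stochastic integrals -/

theorem integral_sum_mul_indicator_sq {α ι : Type*} [MeasurableSpace α] [Fintype ι]
    {μ : Measure α} [IsFiniteMeasure μ] (c : ι → ℝ) {S : ι → Set α}
    (hS : ∀ i, MeasurableSet (S i)) :
    ∫ x, (∑ i, c i * (S i).indicator (fun _ => (1 : ℝ)) x) ^ 2 ∂μ =
      ∑ i, ∑ j, c i * (c j * μ.real (S i ∩ S j)) := by
  have hsq (x : α) : (∑ i, c i * (S i).indicator (fun _ => (1 : ℝ)) x) ^ 2 =
      ∑ i, ∑ j, c i * (c j * (S i ∩ S j).indicator (fun _ => (1 : ℝ)) x) := by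
    rw [sq, Finset.sum_mul_sum]
    refine Finset.sum_congr rfl fun i _ => Finset.sum_congr rfl fun j _ => ?_
    by_cases hi : x ∈ S i <;> by_cases hj : x ∈ S j <;> simp [hi, hj]
  have hint (i j : ι) :
      Integrable (fun x => c i * (c j * (S i ∩ S j).indicator (fun _ => (1 : ℝ)) x)) μ :=
    (((integrable_const 1).indicator ((hS i).inter (hS j))).const_mul _).const_mul _
  simp_rw [hsq]
  rw [integral_finsetSum _ fun i _ => integrable_finsetSum _ fun j _ => hint i j]
  refine Finset.sum_congr rfl fun i _ => ?_
  rw [integral_finsetSum _ fun j _ => hint i j]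
  refine Finset.sum_congr rfl fun j _ => ?_
  rw [integral_const_mul, integral_const_mul,
    integral_indicator_const _ ((hS i).inter (hS j)), smul_eq_mul, mul_one]

theorem covariance_increments_of_isPreBrownianReal {Ω : Type*} [MeasurableSpace Ω] {P : Measure Ω}
    {W : ℝ≥0 → Ω → ℝ} (hW : IsPreBrownianReal W P) {a b a' b' : ℝ≥0} (h : a ≤ b) (h' : a' ≤ b') :
    cov[fun ω => W b ω - W a ω, fun ω => W b' ω - W a' ω; P] =
      volume.real (Ioc (a : ℝ) b ∩ Ioc (a' : ℝ) b') := by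
  have := hW.isGaussianProcess.isProbabilityMeasure
  have hm (s : ℝ≥0) : MemLp (fun ω => W s ω) 2 P :=
    (hW.isGaussianProcess.hasGaussianLaw_eval _).memLp_two
  rw [covariance_fun_sub_fun_sub (hm _) (hm _) (hm _) (hm _), Ioc_inter_Ioc, Real.volume_real_Ioc]
  simp_rw [hW.covariance_fun_eval]
  have hab : (a : ℝ) ≤ b := mod_cast h
  have hab' : (a' : ℝ) ≤ b' := mod_cast h'
  push_cast
  grind

theorem eLpNorm_two_eq_ofReal_sqrt {α : Type*} [MeasurableSpace α] {μ : Measure α} {f : α → ℝ}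
    (hf : MemLp f 2 μ) : eLpNorm f 2 μ = ENNReal.ofReal √(∫ x, f x ^ 2 ∂μ) := by
  rw [hf.eLpNorm_eq_integral_rpow_norm (by simp) (by simp)]
  simp [Real.sqrt_eq_rpow]

/-- The `L^q` norm `(𝔼|ξ|^q)^{1/q}` of a standard normal variable `ξ`, the constant in the
`L^q`-isometry of the Wiener integral. -/
noncomputable def stdNormalLpNorm (q : ℝ≥0∞) : ℝ≥0∞ := eLpNorm id q (gaussianReal 0 1)

theorem stdNormalLpNorm_ne_top {q : ℝ≥0∞} (hq : q ≠ ∞) : stdNormalLpNorm q ≠ ∞ :=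
  (memLp_id_gaussianReal' q hq).eLpNorm_ne_top

theorem eLpNorm_id_gaussianReal (q : ℝ≥0∞) (v : ℝ≥0) :
    eLpNorm id q (gaussianReal 0 v) = stdNormalLpNorm q * ENNReal.ofReal √v := by
  have hmap : (gaussianReal 0 1).map (√(v : ℝ) • id) = gaussianReal 0 v := by
    refine (gaussianReal_map_const_mul √(v : ℝ)).trans ?_
    congr 1
    · simp
    · ext; simp
  rw [← hmap, eLpNorm_map_measure aestronglyMeasurable_id (by fun_prop), Function.id_comp,
    eLpNorm_const_smul, Real.enorm_eq_ofReal (Real.sqrt_nonneg _), mul_comm, stdNormalLpNorm]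

namespace TimeStepFun

variable {s t : ℝ≥0}

theorem Ioc_subset (φ : TimeStepFun t) (i : Fin φ.n) :
    Ioc (φ.left i : ℝ) (φ.right i) ⊆ Ioc 0 (t : ℝ) :=
  Ioc_subset_Ioc (φ.left i).coe_nonneg (mod_cast φ.right_le i)

theorem eval_eq_zero (φ : TimeStepFun t) {r : ℝ} (hr : r ∉ Ioc 0 (t : ℝ)) : φ.eval r = 0 :=
  Finset.sum_eq_zero fun i _ => by
    rw [indicator_of_notMem fun h => hr (φ.Ioc_subset i h), mul_zero]

theorem memLp_eval (φ : TimeStepFun t) (q : ℝ≥0∞) :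
    MemLp φ.eval q (volume.restrict (Ioc 0 (t : ℝ))) :=
  memLp_finsetSum _ fun _ _ =>
    (memLp_indicator_const q measurableSet_Ioc 1 (.inr (by finiteness))).const_mul _

/-- A step function on `(0, s]`, viewed as a step function on `(0, t]` that vanishes on
`(s, t]`. -/
def castLE (h : s ≤ t) (φ : TimeStepFun s) : TimeStepFun t where
  n := φ.n
  coeff := φ.coeff
  left := φ.left
  right := φ.right
  left_le_right := φ.left_le_right
  right_le i := (φ.right_le i).trans h

/-- The difference of two step functions. -/
def sub (φ ψ : TimeStepFun t) : TimeStepFun t where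
  n := φ.n + ψ.n
  coeff := Fin.append φ.coeff fun i => -ψ.coeff i
  left := Fin.append φ.left ψ.left
  right := Fin.append φ.right ψ.right
  left_le_right i := by
    cases i using Fin.addCases with
    | left i => simpa using φ.left_le_right i
    | right i => simpa using ψ.left_le_right i
  right_le i := by
    cases i using Fin.addCases with
    | left i => simpa using φ.right_le i
    | right i => simpa using ψ.right_le i

theorem eval_sub (φ ψ : TimeStepFun t) : (φ.sub ψ).eval = φ.eval - ψ.eval := by
  funext r
  refine (Fin.sum_univ_add _).trans ?_
  simp [eval, sub, sub_eq_add_neg]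

theorem integral_sub {Ω : Type*} (φ ψ : TimeStepFun t) (W : ℝ≥0 → Ω → ℝ) :
    (φ.sub ψ).integral W = φ.integral W - ψ.integral W := by
  funext ω
  refine (Fin.sum_univ_add _).trans ?_
  simp [integral, sub, sub_eq_add_neg]

variable {Ω : Type*} [MeasurableSpace Ω] {P : Measure Ω} {W : ℝ≥0 → Ω → ℝ}

theorem hasGaussianLaw_integral (φ : TimeStepFun t) (hW : IsPreBrownianReal W P) :
    HasGaussianLaw (φ.integral W) P := by
  classical
  have hI : IsGaussianProcess (fun _ : Unit => φ.integral W) P := by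
    refine hW.isGaussianProcess.of_isGaussianProcess fun _ => ?_
    let I : Finset ℝ≥0 := Finset.univ.image φ.left ∪ Finset.univ.image φ.right
    have hl (i) : φ.left i ∈ I := by simp [I]
    have hr (i) : φ.right i ∈ I := by simp [I]
    exact ⟨I, ∑ i, φ.coeff i • (ContinuousLinearMap.proj (R := ℝ) (φ := fun _ : I => ℝ)
      ⟨φ.right i, hr i⟩ - ContinuousLinearMap.proj ⟨φ.left i, hl i⟩), fun ω => by
        simp [integral]⟩
  exact hI.hasGaussianLaw_eval ()

theorem memLp_integral (φ : TimeStepFun t) (hW : IsPreBrownianReal W P) :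
    MemLp (φ.integral W) 2 P :=
  (φ.hasGaussianLaw_integral hW).memLp_two

theorem integral_integral (φ : TimeStepFun t) (hW : IsPreBrownianReal W P) :
    ∫ ω, φ.integral W ω ∂P = 0 := by
  have hincr (i) : Integrable (fun ω => W (φ.right i) ω - W (φ.left i) ω) P :=
    (hW.integrable_eval _).sub (hW.integrable_eval _)
  unfold integral
  rw [integral_finsetSum _ fun i _ => (hincr i).const_mul _]
  refine Finset.sum_eq_zero fun i _ => ?_
  rw [integral_const_mul, MeasureTheory.integral_sub (hW.integrable_eval _) (hW.integrable_eval _),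
    hW.integral_eval, hW.integral_eval, sub_zero, mul_zero]

theorem variance_integral (φ : TimeStepFun t) (hW : IsPreBrownianReal W P) :
    Var[φ.integral W; P] = ∫ r in Ioc 0 (t : ℝ), φ.eval r ^ 2 := by
  have := hW.isGaussianProcess.isProbabilityMeasure
  have hm (s : ℝ≥0) : MemLp (W s) 2 P := (hW.isGaussianProcess.hasGaussianLaw_eval _).memLp_two
  have hterm (i) : MemLp (fun ω => φ.coeff i * (W (φ.right i) ω - W (φ.left i) ω)) 2 P :=
    ((hm _).sub (hm _)).const_mul _
  unfold integral eval
  rw [variance_fun_sum hterm, integral_sum_mul_indicator_sq _ fun _ => measurableSet_Ioc]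
  refine Finset.sum_congr rfl fun i _ => Finset.sum_congr rfl fun j _ => ?_
  rw [covariance_const_mul_left, covariance_const_mul_right,
    covariance_increments_of_isPreBrownianReal hW (φ.left_le_right i) (φ.left_le_right j),
    measureReal_restrict_apply (measurableSet_Ioc.inter measurableSet_Ioc),
    inter_eq_left.2 (inter_subset_left.trans (φ.Ioc_subset i))]

theorem eLpNorm_integral (φ : TimeStepFun t) (hW : IsPreBrownianReal W P) (q : ℝ≥0∞) :
    eLpNorm (φ.integral W) q P =
      stdNormalLpNorm q * eLpNorm φ.eval 2 (volume.restrict (Ioc 0 (t : ℝ))) := by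
  have hlaw := φ.hasGaussianLaw_integral hW
  calc eLpNorm (φ.integral W) q P = eLpNorm id q (P.map (φ.integral W)) :=
        (eLpNorm_map_measure aestronglyMeasurable_id hlaw.aemeasurable).symm
    _ = _ := by
      rw [hlaw.map_eq_gaussianReal, φ.integral_integral hW, φ.variance_integral hW,
        eLpNorm_id_gaussianReal, eLpNorm_two_eq_ofReal_sqrt (φ.memLp_eval 2),
        Real.coe_toNNReal _ (integral_nonneg fun r => sq_nonneg _)]

end TimeStepFun

/-! ### Wiener integrals -/

section Lp

variable {α E : Type*} [MeasurableSpace α] [NormedAddCommGroup E] {μ : Measure α} {p : ℝ≥0∞}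

theorem tendsto_eLpNorm_of_tendsto_eLpNorm_sub {ι : Type*} {l : Filter ι} [Fact (1 ≤ p)]
    {f : ι → α → E} {F : α → E} (hf : ∀ i, MemLp (f i) p μ) (hF : MemLp F p μ)
    (h : Tendsto (fun i => eLpNorm (f i - F) p μ) l (𝓝 0)) :
    Tendsto (fun i => eLpNorm (f i) p μ) l (𝓝 (eLpNorm F p μ)) := by
  simpa only [Lp.enorm_toLp] using ((Lp.tendsto_Lp_iff_tendsto_eLpNorm'' f hf F hF).2 h).enorm

theorem tendsto_eLpNorm_sub_sub {ι : Type*} {l : Filter ι} [Fact (1 ≤ p)] {f g : ι → α → E}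
    {F G : α → E} (hf : ∀ i, MemLp (f i) p μ) (hg : ∀ i, MemLp (g i) p μ) (hF : MemLp F p μ)
    (hG : MemLp G p μ) (h : Tendsto (fun i => eLpNorm (f i - F) p μ) l (𝓝 0))
    (h' : Tendsto (fun i => eLpNorm (g i - G) p μ) l (𝓝 0)) :
    Tendsto (fun i => eLpNorm ((f i - g i) - (F - G)) p μ) l (𝓝 0) :=
  (Lp.tendsto_Lp_iff_tendsto_eLpNorm'' _ (fun i => (hf i).sub (hg i)) _ (hF.sub hG)).1 <|
    ((Lp.tendsto_Lp_iff_tendsto_eLpNorm'' f hf F hF).2 h).sub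
      ((Lp.tendsto_Lp_iff_tendsto_eLpNorm'' g hg G hG).2 h')

theorem eLpNorm_le_of_tendsto_eLpNorm_sub (hp : p ≠ 0) {q C : ℝ≥0∞} {f : ℕ → α → E} {F : α → E}
    (hf : ∀ n, AEStronglyMeasurable (f n) μ) (hF : AEStronglyMeasurable F μ)
    (h : Tendsto (fun n => eLpNorm (f n - F) p μ) atTop (𝓝 0))
    (hC : Tendsto (fun n => eLpNorm (f n) q μ) atTop (𝓝 C)) : eLpNorm F q μ ≤ C := by
  obtain ⟨ns, hns, hae⟩ := (tendstoInMeasure_of_tendsto_eLpNorm hp hf hF h).exists_seq_tendsto_ae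
  exact (Lp.eLpNorm_lim_le_liminf_eLpNorm (fun k => hf (ns k)) F hae).trans
    (hC.comp hns.tendsto_atTop).liminf_eq.le

end Lp

namespace IsWienerIntegral

variable {Ω : Type*} [MeasurableSpace Ω] {P : Measure Ω} {W : ℝ≥0 → Ω → ℝ} {s t : ℝ≥0}
  {f f' : ℝ → ℝ} {J J' : Ω → ℝ}

theorem congr_ae (hJ : IsWienerIntegral P W t f J) (h : J =ᵐ[P] J') :
    IsWienerIntegral P W t f J' := by
  obtain ⟨hf, hJm, φ, hφ, hφJ⟩ := hJ
  refine ⟨hf, (memLp_congr_ae h).1 hJm, φ, hφ, hφJ.congr fun k => eLpNorm_congr_ae ?_⟩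
  filter_upwards [h] with ω hω
  rw [hω]

theorem castLE (hJ : IsWienerIntegral P W s f J) (h : s ≤ t) :
    IsWienerIntegral P W t ((Ioc 0 (s : ℝ)).indicator f) J := by
  obtain ⟨hf, hJm, φ, hφ, hφJ⟩ := hJ
  have hres : (volume.restrict (Ioc 0 (t : ℝ))).restrict (Ioc 0 (s : ℝ)) =
      volume.restrict (Ioc 0 (s : ℝ)) :=
    Measure.restrict_restrict_of_subset (Ioc_subset_Ioc_right (mod_cast h))
  refine ⟨(memLp_indicator_iff_restrict measurableSet_Ioc).2 (hres ▸ hf), hJm,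
    fun k => (φ k).castLE h, hφ.congr fun k => ?_, hφJ⟩
  rw [← hres, ← eLpNorm_indicator_eq_eLpNorm_restrict measurableSet_Ioc]
  congr 1
  funext r
  by_cases hr : r ∈ Ioc 0 (s : ℝ)
  · simp only [indicator_of_mem hr]
    rfl
  · simp only [indicator_of_notMem hr, sub_zero]
    exact ((φ k).eval_eq_zero hr).symm

theorem sub (hJ : IsWienerIntegral P W t f J) (hJ' : IsWienerIntegral P W t f' J')
    (hW : IsPreBrownianReal W P) : IsWienerIntegral P W t (f - f') (J - J') := by
  obtain ⟨hf, hJm, φ, hφ, hφJ⟩ := hJ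
  obtain ⟨hf', hJm', ψ, hψ, hψJ⟩ := hJ'
  refine ⟨hf.sub hf', hJm.sub hJm', fun k => (φ k).sub (ψ k), ?_, ?_⟩
  · simp_rw [TimeStepFun.eval_sub]
    exact tendsto_eLpNorm_sub_sub (fun k => (φ k).memLp_eval 2) (fun k => (ψ k).memLp_eval 2)
      hf hf' hφ hψ
  · simp_rw [TimeStepFun.integral_sub]
    exact tendsto_eLpNorm_sub_sub (fun k => (φ k).memLp_integral hW)
      (fun k => (ψ k).memLp_integral hW) hJm hJm' hφJ hψJ

theorem eLpNorm_le (hJ : IsWienerIntegral P W t f J) (hW : IsPreBrownianReal W P) {q : ℝ≥0∞}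
    (hq : q ≠ ∞) :
    eLpNorm J q P ≤ stdNormalLpNorm q * eLpNorm f 2 (volume.restrict (Ioc 0 (t : ℝ))) := by
  obtain ⟨hf, hJm, φ, hφ, hφJ⟩ := hJ
  refine eLpNorm_le_of_tendsto_eLpNorm_sub two_ne_zero (fun k => ((φ k).memLp_integral hW).1)
    hJm.1 hφJ ?_
  simp_rw [TimeStepFun.eLpNorm_integral _ hW]
  exact ENNReal.Tendsto.const_mul
    (tendsto_eLpNorm_of_tendsto_eLpNorm_sub (fun k => (φ k).memLp_eval 2) hf hφ)
    (.inr (stdNormalLpNorm_ne_top hq))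

theorem eLpNorm_sub_le (hJ : IsWienerIntegral P W t f J) (hJ' : IsWienerIntegral P W s f' J')
    (hst : s ≤ t) (hW : IsPreBrownianReal W P) {q : ℝ≥0∞} (hq : q ≠ ∞) :
    eLpNorm (J - J') q P ≤ stdNormalLpNorm q *
      eLpNorm (f - (Ioc 0 (s : ℝ)).indicator f') 2 (volume.restrict (Ioc 0 (t : ℝ))) :=
  (hJ.sub (hJ'.castLE hst) hW).eLpNorm_le hW hq

end IsWienerIntegral

namespace TimeStepFun

variable {t : ℝ≥0} {n : ℕ} {r : ℝ}

/-- The step function taking the value `g (t (i + 1) / n)` on `(t i / n, t (i + 1) / n]`, which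
approximates a continuous function `g` on `(0, t]`. -/
noncomputable def sample (t : ℝ≥0) (n : ℕ) (g : ℝ → ℝ) : TimeStepFun t where
  n := n
  coeff i := g (t * (i + 1) / n)
  left i := t * i / n
  right i := t * (i + 1) / n
  left_le_right i := by gcongr; simp
  right_le i := by
    have hi : ((i : ℕ) : ℝ≥0) + 1 ≤ n := mod_cast i.2
    exact div_le_of_le_mul₀ zero_le zero_le (by gcongr)

theorem mem_Ioc_node_iff (hn : 0 < n) (hr : r ∈ Ioc 0 (t : ℝ)) (i : ℕ) :
    r ∈ Ioc ((t : ℝ) * i / n) (t * (i + 1) / n) ↔ ⌈r * n / t⌉₊ = i + 1 := by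
  have ht : (0 : ℝ) < t := hr.1.trans_le hr.2
  have hn' : (0 : ℝ) < n := mod_cast hn
  rw [Nat.ceil_eq_iff i.succ_ne_zero, mem_Ioc, div_lt_iff₀ hn', le_div_iff₀ hn',
    lt_div_iff₀ ht, div_le_iff₀ ht, mul_comm (t : ℝ), mul_comm (t : ℝ)]
  push_cast
  simp

theorem exists_ceil_eq (hn : 0 < n) (hr : r ∈ Ioc 0 (t : ℝ)) :
    ∃ i : Fin n, ⌈r * n / t⌉₊ = (i : ℕ) + 1 := by
  have ht : (0 : ℝ) < t := hr.1.trans_le hr.2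
  have hpos : 0 < ⌈r * n / t⌉₊ :=
    Nat.ceil_pos.2 (div_pos (mul_pos hr.1 (mod_cast hn)) ht)
  have hle : ⌈r * n / t⌉₊ ≤ n := by
    rw [Nat.ceil_le, div_le_iff₀ ht, mul_comm]
    exact mul_le_mul_of_nonneg_left hr.2 n.cast_nonneg
  exact ⟨⟨⌈r * n / t⌉₊ - 1, by omega⟩, by simp only; omega⟩

theorem eval_sample (hn : 0 < n) (g : ℝ → ℝ) (hr : r ∈ Ioc 0 (t : ℝ)) :
    (sample t n g).eval r = g (t * ⌈r * n / t⌉₊ / n) := by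
  obtain ⟨i, hi⟩ := exists_ceil_eq hn hr
  have hmem (j : Fin n) : r ∈ Ioc (((sample t n g).left j : ℝ)) ((sample t n g).right j) ↔
      j = i := by
    simp only [sample]
    push_cast
    rw [mem_Ioc_node_iff hn hr, hi, Fin.ext_iff]
    omega
  refine (Finset.sum_eq_single i (fun j _ hj => ?_) (fun h => absurd (Finset.mem_univ _) h)).trans
    ?_
  · rw [indicator_of_notMem (mt (hmem j).1 hj), mul_zero]
  · rw [indicator_of_mem ((hmem i).2 rfl), mul_one, hi]
    push_cast
    rfl

theorem abs_node_sub_le (hn : 0 < n) (hr : r ∈ Ioc 0 (t : ℝ)) :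
    |t * ⌈r * n / t⌉₊ / n - r| ≤ t / n := by
  obtain ⟨i, hi⟩ := exists_ceil_eq hn hr
  obtain ⟨hlt, hle⟩ := (mem_Ioc_node_iff hn hr i).2 hi
  rw [mul_add_one, add_div] at hle
  rw [hi, abs_le]
  push_cast
  rw [mul_add_one, add_div]
  constructor <;> linarith [t.coe_nonneg, div_nonneg t.coe_nonneg (n.cast_nonneg (α := ℝ))]

theorem exists_norm_eval_sub_le {g : ℝ → ℝ} (hg : UniformContinuous g) {η : ℝ} (hη : 0 < η) :
    ∃ φ : TimeStepFun t, ∀ r ∈ Ioc 0 (t : ℝ), ‖φ.eval r - g r‖ ≤ η := by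
  obtain ⟨δ, hδ, hgδ⟩ := Metric.uniformContinuous_iff.1 hg η hη
  obtain ⟨n, hn⟩ := exists_nat_gt (t / δ)
  have hn' : (0 : ℝ) < n := (by positivity : 0 ≤ t / δ).trans_lt hn
  refine ⟨sample t n g, fun r hr => ?_⟩
  rw [eval_sample (mod_cast hn') g hr, ← dist_eq_norm]
  refine (hgδ ((abs_node_sub_le (mod_cast hn') hr).trans_lt ?_)).le
  rwa [div_lt_comm₀ hn' hδ]

theorem exists_eLpNorm_eval_sub_le {f : ℝ → ℝ} {p : ℝ≥0∞} (hp : 1 ≤ p) (hp' : p ≠ ∞)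
    (hf : MemLp f p (volume.restrict (Ioc 0 (t : ℝ)))) {ε : ℝ≥0∞} (hε : ε ≠ 0) :
    ∃ φ : TimeStepFun t, eLpNorm (φ.eval - f) p (volume.restrict (Ioc 0 (t : ℝ))) ≤ ε := by
  have hε2 : ε / 2 ≠ 0 := by simpa using hε
  obtain ⟨g, hgc, hfg, hgcont, hgm⟩ := hf.exists_hasCompactSupport_eLpNorm_sub_le hp' hε2
  obtain ⟨η, hη, hηε⟩ := ENNReal.exists_nnreal_pos_mul_lt
    (a := volume.restrict (Ioc 0 (t : ℝ)) univ ^ p.toReal⁻¹) (by finiteness) hε2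
  obtain ⟨φ, hφ⟩ := exists_norm_eval_sub_le (t := t)
    (hgc.uniformContinuous_of_continuous hgcont) (NNReal.coe_pos.2 hη)
  refine ⟨φ, ?_⟩
  calc eLpNorm (φ.eval - f) p (volume.restrict (Ioc 0 (t : ℝ)))
      = eLpNorm ((φ.eval - g) - (f - g)) p (volume.restrict (Ioc 0 (t : ℝ))) := by
        rw [sub_sub_sub_cancel_right]
    _ ≤ eLpNorm (φ.eval - g) p (volume.restrict (Ioc 0 (t : ℝ))) +
        eLpNorm (f - g) p (volume.restrict (Ioc 0 (t : ℝ))) :=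
      eLpNorm_sub_le ((φ.memLp_eval p).sub hgm).1 (hf.sub hgm).1 hp
    _ ≤ ε / 2 + ε / 2 := by
      gcongr
      refine (eLpNorm_le_of_ae_bound ((ae_restrict_mem measurableSet_Ioc).mono hφ)).trans ?_
      rw [ENNReal.ofReal_coe_nnreal, mul_comm]
      exact hηε.le
    _ = ε := ENNReal.add_halves ε

end TimeStepFun

theorem exists_isWienerIntegral {Ω : Type*} [MeasurableSpace Ω] {P : Measure Ω}
    {W : ℝ≥0 → Ω → ℝ} (hW : IsPreBrownianReal W P) {t : ℝ≥0} {f : ℝ → ℝ}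
    (hf : MemLp f 2 (volume.restrict (Ioc 0 (t : ℝ)))) :
    ∃ J : Lp ℝ 2 P, IsWienerIntegral P W t f J := by
  choose φ hφ using fun k : ℕ => TimeStepFun.exists_eLpNorm_eval_sub_le one_le_two (by simp) hf
    (ε := 2⁻¹ ^ k) (pow_ne_zero _ (by simp))
  have hφf : Tendsto (fun k => eLpNorm ((φ k).eval - f) 2 (volume.restrict (Ioc 0 (t : ℝ))))
      atTop (𝓝 0) :=
    tendsto_of_tendsto_of_tendsto_of_le_of_le tendsto_const_nhds
      (ENNReal.tendsto_pow_atTop_nhds_zero_of_lt_one (by simp [ENNReal.inv_lt_one]))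
      (fun _ => zero_le) hφ
  have heval : CauchySeq fun k => ((φ k).memLp_eval 2).toLp :=
    ((Lp.tendsto_Lp_iff_tendsto_eLpNorm'' _ _ f hf).2 hφf).cauchySeq
  have hmem (k) := (φ k).memLp_integral hW
  have hisom (k l) : edist (hmem k).toLp (hmem l).toLp =
      stdNormalLpNorm 2 * edist ((φ k).memLp_eval 2).toLp ((φ l).memLp_eval 2).toLp := by
    rw [Lp.edist_toLp_toLp, Lp.edist_toLp_toLp, ← TimeStepFun.integral_sub,
      ← TimeStepFun.eval_sub, TimeStepFun.eLpNorm_integral _ hW]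
  have hcauchy : CauchySeq fun k => (hmem k).toLp := by
    obtain ⟨b, hb, hb0⟩ := EMetric.cauchySeq_iff_le_tendsto_0.1 heval
    refine EMetric.cauchySeq_iff_le_tendsto_0.2 ⟨fun k => stdNormalLpNorm 2 * b k,
      fun k l N hk hl => (hisom k l).trans_le (mul_le_mul_right (hb k l N hk hl) _), ?_⟩
    simpa using ENNReal.Tendsto.const_mul hb0 (.inr (stdNormalLpNorm_ne_top (by simp)))
  obtain ⟨J, hJ⟩ := cauchySeq_tendsto_of_complete hcauchy
  refine ⟨J, hf, Lp.memLp J, φ, hφf, ?_⟩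
  rw [← Lp.toLp_coeFn J (Lp.memLp J)] at hJ
  exact (Lp.tendsto_Lp_iff_tendsto_eLpNorm'' _ hmem J (Lp.memLp J)).1 hJ

/-! ### Jointly measurable versions -/

section MeasurableVersion

variable {α Ω E : Type*} [MeasurableSpace α] [MeasurableSpace Ω] [NormedAddCommGroup E]
  {P : Measure Ω} {p : ℝ≥0∞}

theorem ae_tendsto_of_tsum_eLpNorm_sub_ne_top [CompleteSpace E] (hp : 1 ≤ p) {f : ℕ → Ω → E}
    {F : Ω → E} (hf : ∀ k, AEStronglyMeasurable (f k) P) (hF : AEStronglyMeasurable F P)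
    {B : ℕ → ℝ≥0∞} (hBanti : Antitone B) (hB : ∑' k, B k ≠ ∞)
    (hfB : ∀ k, eLpNorm (f k - F) p P < B k) :
    ∀ᵐ ω ∂P, Tendsto (fun k => f k ω) atTop (𝓝 (F ω)) := by
  have hcauchy : ∀ᵐ ω ∂P, ∃ l, Tendsto (fun k => f k ω) atTop (𝓝 l) := by
    refine Lp.ae_tendsto_of_cauchy_eLpNorm hf hp (B := fun k => 2 * B k)
      (by rw [ENNReal.tsum_mul_left]; finiteness) fun N n m hn hm => ?_
    calc eLpNorm (f n - f m) p P = eLpNorm ((f n - F) - (f m - F)) p P := by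
          rw [sub_sub_sub_cancel_right]
      _ ≤ eLpNorm (f n - F) p P + eLpNorm (f m - F) p P :=
        eLpNorm_sub_le ((hf n).sub hF) ((hf m).sub hF) hp
      _ < B N + B N :=
        ENNReal.add_lt_add ((hfB n).trans_le (hBanti hn)) ((hfB m).trans_le (hBanti hm))
      _ = 2 * B N := (two_mul _).symm
  have hlim : Tendsto (fun k => eLpNorm (f k - F) p P) atTop (𝓝 0) :=
    tendsto_of_tendsto_of_tendsto_of_le_of_le tendsto_const_nhds
      (ENNReal.tendsto_atTop_zero_of_tsum_ne_top hB) (fun _ => zero_le) fun k => (hfB k).le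
  obtain ⟨ns, hns, hsub⟩ := (tendstoInMeasure_of_tendsto_eLpNorm
    (zero_lt_one.trans_le hp).ne' hf hF hlim).exists_seq_tendsto_ae
  filter_upwards [hcauchy, hsub] with ω ⟨l, hl⟩ hω
  rwa [tendsto_nhds_unique hω (hl.comp hns.tendsto_atTop)]

variable [MeasurableSpace E] [BorelSpace E]

theorem measurable_simpleFunc_Lp (f : SimpleFunc α (Lp E p P)) :
    Measurable fun x : α × Ω => f x.1 x.2 :=
  (f.comp Prod.fst measurable_fst).measurable_bind (fun (h : Lp E p P) x => h x.2) fun h =>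
    (Lp.stronglyMeasurable h).measurable.comp measurable_snd

theorem exists_measurable_edist_lt [Fact (1 ≤ p)] {F : α → Lp E p P} (hF : StronglyMeasurable F)
    {ε : ℝ≥0∞} (hε : 0 < ε) :
    ∃ v : α → Lp E p P, Measurable (fun x : α × Ω => v x.1 x.2) ∧ ∀ X, edist (v X) (F X) < ε := by
  classical
  have hex (X : α) : ∃ n, edist (hF.approx n X) (F X) < ε :=
    ((tendsto_iff_edist_tendsto_0.1 (hF.tendsto_approx X)).eventually_lt_const hε).exists
  have hidx : Measurable fun X => Nat.find (hex X) := measurable_find hex fun n =>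
    measurableSet_lt (continuous_edist.comp_stronglyMeasurable
      ((hF.approx n).stronglyMeasurable.prodMk hF)).measurable measurable_const
  have hjoint : Measurable fun x : ℕ × α × Ω => hF.approx x.1 x.2.1 x.2.2 :=
    measurable_from_prod_countable_right fun n => measurable_simpleFunc_Lp (hF.approx n)
  exact ⟨fun X => hF.approx (Nat.find (hex X)) X,
    hjoint.comp ((hidx.comp measurable_fst).prodMk measurable_id), fun X => Nat.find_spec (hex X)⟩

theorem exists_measurable_version [CompleteSpace E] [SecondCountableTopology E] [Fact (1 ≤ p)]
    {F : α → Lp E p P} (hF : StronglyMeasurable F) :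
    ∃ u : α → Ω → E, Measurable (Function.uncurry u) ∧ ∀ X, u X =ᵐ[P] F X := by
  choose v hvm hv using fun k : ℕ =>
    exists_measurable_edist_lt hF (ENNReal.pow_pos (a := 2⁻¹) (by simp) k)
  refine ⟨fun X ω => limUnder atTop fun k => v k X ω,
    (StronglyMeasurable.limUnder fun k => (hvm k).stronglyMeasurable).measurable, fun X => ?_⟩
  have hconv : ∀ᵐ ω ∂P, Tendsto (fun k => v k X ω) atTop (𝓝 (F X ω)) := by
    refine ae_tendsto_of_tsum_eLpNorm_sub_ne_top (p := p) Fact.out (fun k => (Lp.memLp (v k X)).1)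
      (Lp.memLp (F X)).1 (B := fun k => 2⁻¹ ^ k) (pow_right_anti₀ zero_le (by simp)) ?_ fun k => ?_
    · simp [ENNReal.tsum_geometric]
    · rw [← Lp.edist_def]
      exact hv k X
  filter_upwards [hconv] with ω hω using hω.limUnder_eq

end MeasurableVersion

/-! ### The parabolic distance -/

section ParabolicDist

variable {d : ℕ}

theorem parabolicDist_comm (X Y : SpaceTime d) : parabolicDist X Y = parabolicDist Y X := by
  rw [parabolicDist, parabolicDist, norm_sub_rev, abs_sub_comm]

theorem parabolicDist_self (X : SpaceTime d) : parabolicDist X X = 0 := by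
  simp [parabolicDist]

theorem parabolicDist_triangle (X Y Z : SpaceTime d) :
    parabolicDist X Z ≤ parabolicDist X Y + parabolicDist Y Z := by
  refine max_le ?_ ?_
  · exact (norm_sub_le_norm_sub_add_norm_sub _ _ _).trans
      (add_le_add (le_max_left _ _) (le_max_left _ _))
  · calc |X.1 - Z.1| ^ (1 / 2 : ℝ)
        ≤ (|X.1 - Y.1| + |Y.1 - Z.1|) ^ (1 / 2 : ℝ) := by gcongr; exact abs_sub_le _ _ _
      _ ≤ |X.1 - Y.1| ^ (1 / 2 : ℝ) + |Y.1 - Z.1| ^ (1 / 2 : ℝ) :=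
        Real.rpow_add_le_add_rpow (abs_nonneg _) (abs_nonneg _) (by norm_num) (by norm_num)
      _ ≤ parabolicDist X Y + parabolicDist Y Z :=
        add_le_add (le_max_right _ _) (le_max_right _ _)

theorem continuous_parabolicDist :
    Continuous fun q : SpaceTime d × SpaceTime d => parabolicDist q.1 q.2 := by
  unfold parabolicDist
  have hrpow : Continuous fun τ : ℝ => τ ^ (1 / 2 : ℝ) := Real.continuous_rpow_const (by norm_num)
  fun_prop

theorem edist_snd_le_ofReal_parabolicDist (X Y : SpaceTime d) :
    edist X.2 Y.2 ≤ ENNReal.ofReal (parabolicDist X Y) := by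
  rw [edist_dist, dist_eq_norm]
  exact ENNReal.ofReal_le_ofReal (le_max_left _ _)

theorem mul_ofReal_sub_rpow_rpow_half_le {X Y : SpaceTime d} (h : Y.1 ≤ X.1) {γ : ℝ} (hγ : 0 ≤ γ)
    (N : ℝ≥0∞) :
    (N * ENNReal.ofReal ((X.1 - Y.1) ^ γ)) ^ (1 / 2 : ℝ) ≤
      N ^ (1 / 2 : ℝ) * ENNReal.ofReal (parabolicDist X Y) ^ γ := by
  have hd : 0 ≤ X.1 - Y.1 := sub_nonneg.2 h
  rw [ENNReal.mul_rpow_of_nonneg _ _ (by norm_num), ← ENNReal.ofReal_rpow_of_nonneg hd hγ,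
    ← ENNReal.rpow_mul, mul_comm γ, ENNReal.rpow_mul,
    ENNReal.ofReal_rpow_of_nonneg hd (by norm_num)]
  gcongr
  exact (abs_of_nonneg hd).symm ▸ le_max_right _ _

theorem parabolicDist_le_of_mem_closedBall {X Y : SpaceTime d} {R : ℝ}
    (hX : X ∈ Metric.closedBall 0 R) (hY : Y ∈ Metric.closedBall 0 R) :
    parabolicDist X Y ≤ max (2 * R) ((2 * R) ^ (1 / 2 : ℝ)) := by
  have hXY : ‖X - Y‖ ≤ 2 * R := by
    rw [mem_closedBall_zero_iff] at hX hY
    linarith [norm_sub_le X Y]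
  exact max_le_max ((norm_snd_le (X - Y)).trans hXY)
    (Real.rpow_le_rpow (abs_nonneg _) ((norm_fst_le (X - Y)).trans hXY) (by norm_num))

end ParabolicDist

/-! ### The deterministic convolution -/

section Lp

variable {α E : Type*} [MeasurableSpace α] {μ : Measure α} [NormedAddCommGroup E]

theorem eLpNorm_two_le_of_ae_enorm_le {F : α → E} {h : α → ℝ≥0∞} {c : ℝ≥0} {B : ℝ≥0∞}
    (hF : ∀ᵐ r ∂μ, ‖F r‖ₑ ≤ c * h r) (hB : ∫⁻ r, h r ^ 2 ∂μ ≤ B) :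
    eLpNorm F 2 μ ≤ c * B ^ (1 / 2 : ℝ) := by
  have hsq : ∫⁻ r, ‖F r‖ₑ ^ 2 ∂μ ≤ (c : ℝ≥0∞) ^ 2 * B := by
    calc ∫⁻ r, ‖F r‖ₑ ^ 2 ∂μ ≤ ∫⁻ r, (c : ℝ≥0∞) ^ 2 * h r ^ 2 ∂μ := by
          refine lintegral_mono_ae (hF.mono fun r hr => ?_)
          rw [← mul_pow]
          gcongr
      _ ≤ (c : ℝ≥0∞) ^ 2 * B := by
          rw [lintegral_const_mul' _ _ (by finiteness)]
          gcongr
  calc eLpNorm F 2 μ = (∫⁻ r, ‖F r‖ₑ ^ 2 ∂μ) ^ (1 / 2 : ℝ) := by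
        simp [eLpNorm_eq_lintegral_rpow_enorm_toReal]
    _ ≤ ((c : ℝ≥0∞) ^ 2 * B) ^ (1 / 2 : ℝ) := by gcongr
    _ = c * B ^ (1 / 2 : ℝ) := by
        rw [ENNReal.mul_rpow_of_nonneg _ _ (by norm_num), ← ENNReal.rpow_natCast,
          ← ENNReal.rpow_mul]
        norm_num

theorem eLpNorm_sub_indicator_le {f f' : α → E} {q : ℝ≥0∞} (hq : 1 ≤ q)
    (hf : AEStronglyMeasurable f μ) (hf' : AEStronglyMeasurable f' μ) {S U : Set α}
    (hS : MeasurableSet S) (hSU : S ⊆ U) :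
    eLpNorm (f - S.indicator f') q (μ.restrict U) ≤
      eLpNorm (f - f') q (μ.restrict S) + eLpNorm f q (μ.restrict (U \ S)) := by
  have hsplit : f - S.indicator f' = S.indicator (f - f') + Sᶜ.indicator f := by
    rw [indicator_sub', ← add_sub_right_comm, indicator_self_add_compl]
  rw [hsplit]
  refine (eLpNorm_add_le ((hf.sub hf').indicator hS).restrict
    (hf.indicator hS.compl).restrict hq).trans_eq ?_
  rw [eLpNorm_indicator_eq_eLpNorm_restrict hS, Measure.restrict_restrict_of_subset hSU,
    eLpNorm_indicator_eq_eLpNorm_restrict hS.compl, Measure.restrict_restrict hS.compl,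
    inter_comm, sdiff_eq]

end Lp

section HolderWeight

variable {E : Type*} [SeminormedAddCommGroup E] {g : E → ℝ} {C β R : ℝ≥0}

theorem enorm_apply_sub_le_of_holderWith (hg : HolderWith C β g) (g0 : g 0 = 0) (hβ1 : β ≤ 1)
    {x : E} (hx : ‖x‖ ≤ R) (y : E) :
    ‖g (x - y)‖ₑ ≤ (C * (1 + R ^ (β : ℝ)) : ℝ≥0) * ENNReal.ofReal (1 + ‖y‖ ^ (β : ℝ)) := by
  have hweight : ENNReal.ofReal (1 + ‖y‖ ^ (β : ℝ)) = 1 + ‖y‖ₑ ^ (β : ℝ) := by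
    rw [ENNReal.ofReal_add zero_le_one (by positivity), ENNReal.ofReal_one,
      ← ENNReal.ofReal_rpow_of_nonneg (norm_nonneg _) β.coe_nonneg, ofReal_norm]
  have hxR : ‖x‖ₑ ≤ R := ENNReal.coe_le_coe.2 hx
  calc ‖g (x - y)‖ₑ ≤ C * ‖x - y‖ₑ ^ (β : ℝ) := by simpa [g0] using hg (x - y) 0
    _ ≤ C * (R + ‖y‖ₑ) ^ (β : ℝ) := by gcongr; exact enorm_sub_le.trans (by gcongr)
    _ ≤ C * ((R : ℝ≥0∞) ^ (β : ℝ) + ‖y‖ₑ ^ (β : ℝ)) := by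
      gcongr
      exact ENNReal.rpow_add_le_add_rpow _ _ β.coe_nonneg hβ1
    _ ≤ C * ((1 + (R : ℝ≥0∞) ^ (β : ℝ)) * (1 + ‖y‖ₑ ^ (β : ℝ))) := by
      gcongr
      rw [add_mul, one_mul, mul_add, mul_one, add_comm]
      exact add_le_add le_add_self le_self_add
    _ = _ := by
      rw [hweight, ← mul_assoc]
      push_cast [ENNReal.coe_rpow_of_nonneg R β.coe_nonneg]
      rfl

theorem lintegral_enorm_mul_le_of_holderWith [MeasurableSpace E] {μ : Measure E}
    (hg : HolderWith C β g) (g0 : g 0 = 0) (hβ1 : β ≤ 1) {x : E} (hx : ‖x‖ ≤ R) (k : E → ℝ) :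
    ∫⁻ y, ‖k y * g (x - y)‖ₑ ∂μ ≤
      (C * (1 + R ^ (β : ℝ)) : ℝ≥0) * ∫⁻ y, ‖k y‖ₑ * ENNReal.ofReal (1 + ‖y‖ ^ (β : ℝ)) ∂μ := by
  rw [← lintegral_const_mul' _ _ ENNReal.coe_ne_top]
  refine lintegral_mono fun y => ?_
  rw [enorm_mul, mul_left_comm]
  gcongr
  exact enorm_apply_sub_le_of_holderWith hg g0 hβ1 hx y

theorem lintegral_enorm_mul_sub_le_of_holderWith [MeasurableSpace E] {μ : Measure E}
    (hg : HolderWith C β g) (x x' : E) (k : E → ℝ) :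
    ∫⁻ y, ‖k y * (g (x - y) - g (x' - y))‖ₑ ∂μ ≤
      (C * nndist x x' ^ (β : ℝ) : ℝ≥0) * ∫⁻ y, ‖k y‖ₑ ∂μ := by
  rw [← lintegral_const_mul' _ _ ENNReal.coe_ne_top]
  refine lintegral_mono fun y => ?_
  rw [enorm_mul, mul_comm, ENNReal.coe_mul, ENNReal.coe_rpow_of_nonneg _ β.coe_nonneg,
    ← edist_nndist, ← edist_eq_enorm_sub, ← edist_sub_right x x' y]
  gcongr
  exact hg _ _

end HolderWeight

section Kernel

variable {d : ℕ} {K : ℝ → EuclideanSpace ℝ (Fin d) → ℝ} {g : EuclideanSpace ℝ (Fin d) → ℝ}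
  {T : EReal} {β : ℝ≥0} {γ₁ γ₂ : ℝ} {N₀ N₁ Cg R : ℝ≥0}

/-- The spatial convolution `(K(t - r, ·) * g)(x)`, as a function of `r`: the deterministic
integrand of the stochastic convolution at `X = (t, x)`. -/
noncomputable def convIntegrand (K : ℝ → EuclideanSpace ℝ (Fin d) → ℝ)
    (g : EuclideanSpace ℝ (Fin d) → ℝ) (X : SpaceTime d) (r : ℝ) : ℝ :=
  ∫ y, K (X.1 - r) y * g (X.2 - y)

theorem stronglyMeasurable_convIntegrand (hK : Measurable (Function.uncurry K))
    (hg : Measurable g) (X : SpaceTime d) : StronglyMeasurable (convIntegrand K g X) := by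
  refine StronglyMeasurable.integral_prod_right (f := fun r y => K (X.1 - r) y * g (X.2 - y)) ?_
  exact ((hK.comp ((measurable_const.sub measurable_fst).prodMk measurable_snd)).mul
    (hg.comp (measurable_const.sub measurable_snd))).stronglyMeasurable

theorem measurable_lintegral_weighted (hK : Measurable (Function.uncurry K)) (β t : ℝ) :
    Measurable fun r => ∫⁻ z, ‖K (t - r) z‖ₑ * ENNReal.ofReal (1 + ‖z‖ ^ β) := by
  refine Measurable.lintegral_prod_right'
    (f := fun q => ‖K (t - q.1) q.2‖ₑ * ENNReal.ofReal (1 + ‖q.2‖ ^ β)) ?_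
  exact (hK.comp ((measurable_const.sub measurable_fst).prodMk measurable_snd)).enorm.mul
    (by fun_prop)

theorem KernelConditions.ae_integrable (hK : KernelConditions K T β γ₁ γ₂ N₀ N₁)
    (hg : HolderWith Cg β g) (g0 : g 0 = 0) (hβ : 0 < β) (hβ1 : β ≤ 1) {X : SpaceTime d}
    (hX : X ∈ timeStrip d T) :
    ∀ᵐ r ∂volume.restrict (Ioc 0 X.1), Integrable fun y => K (X.1 - r) y * g (X.2 - y) := by
  have hfinite : ∫⁻ r in Ioc 0 X.1,
      (∫⁻ z, ‖K (X.1 - r) z‖ₑ * ENNReal.ofReal (1 + ‖z‖ ^ (β : ℝ))) ^ 2 ≠ ∞ :=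
    ne_top_of_le_ne_top (by finiteness) (hK.short_time 0 X.1 le_rfl hX.1 hX.2.le)
  filter_upwards [ae_lt_top ((measurable_lintegral_weighted hK.measurable β X.1).pow_const 2)
    hfinite] with r hr
  have hr' : ∫⁻ z, ‖K (X.1 - r) z‖ₑ * ENNReal.ofReal (1 + ‖z‖ ^ (β : ℝ)) < ∞ := by simpa using hr
  refine ⟨?_, (lintegral_enorm_mul_le_of_holderWith hg g0 hβ1 (R := ‖X.2‖₊) le_rfl _).trans_lt
    (ENNReal.mul_lt_top ENNReal.coe_lt_top hr')⟩
  exact ((hK.measurable.comp measurable_prodMk_left).mul ((hg.continuous hβ).comp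
    (continuous_const.sub continuous_id)).measurable).aestronglyMeasurable

theorem KernelConditions.eLpNorm_convIntegrand_time_sub_le
    (hK : KernelConditions K T β γ₁ γ₂ N₀ N₁) (hg : HolderWith Cg β g) (g0 : g 0 = 0) (hβ : 0 < β)
    (hβ1 : β ≤ 1) {s t : ℝ} (hs : 0 < s) (hst : s ≤ t) (htT : (t : EReal) < T)
    {x : EuclideanSpace ℝ (Fin d)} (hx : ‖x‖ ≤ R) :
    eLpNorm (convIntegrand K g (t, x) - convIntegrand K g (s, x)) 2 (volume.restrict (Ioc 0 s)) ≤
      (Cg * (1 + R ^ (β : ℝ)) : ℝ≥0) *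
        (N₁ * ENNReal.ofReal ((t - s) ^ γ₁)) ^ (1 / 2 : ℝ) := by
  have hsT : (s : EReal) < T := lt_of_le_of_lt (by exact_mod_cast hst) htT
  have hint : ∀ᵐ r ∂volume.restrict (Ioc 0 s), Integrable fun y => K (t - r) y * g (x - y) :=
    ae_restrict_of_ae_restrict_of_subset (Ioc_subset_Ioc le_rfl hst)
      (hK.ae_integrable hg g0 hβ hβ1 (X := (t, x)) ⟨hs.trans_le hst, htT⟩)
  refine eLpNorm_two_le_of_ae_enorm_le (h := fun r => ∫⁻ z, ‖K (t - r) z - K (s - r) z‖ₑ *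
    ENNReal.ofReal (1 + ‖z‖ ^ (β : ℝ))) ?_ ?_
  · filter_upwards [hint, hK.ae_integrable hg g0 hβ hβ1 (X := (s, x)) ⟨hs, hsT⟩] with r ht hs
    simp only [Pi.sub_apply, convIntegrand]
    rw [← integral_sub ht hs]
    simp only [← sub_mul]
    exact (enorm_integral_le_lintegral_enorm _).trans
      (lintegral_enorm_mul_le_of_holderWith hg g0 hβ1 hx _)
  · rcases hst.eq_or_lt with rfl | hlt
    · simp
    · exact hK.time_increment s t hs.le hlt htT.le

theorem KernelConditions.eLpNorm_convIntegrand_space_sub_le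
    (hK : KernelConditions K T β γ₁ γ₂ N₀ N₁) (hg : HolderWith Cg β g) (g0 : g 0 = 0) (hβ : 0 < β)
    (hβ1 : β ≤ 1) {s : ℝ} (hs : 0 < s) (hsT : (s : EReal) < T) (x x' : EuclideanSpace ℝ (Fin d)) :
    eLpNorm (convIntegrand K g (s, x) - convIntegrand K g (s, x')) 2 (volume.restrict (Ioc 0 s)) ≤
      (Cg * nndist x x' ^ (β : ℝ) : ℝ≥0) * (N₀ : ℝ≥0∞) ^ (1 / 2 : ℝ) := by
  refine eLpNorm_two_le_of_ae_enorm_le (h := fun r => ∫⁻ z, ‖K (s - r) z‖ₑ) ?_ ?_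
  · filter_upwards [hK.ae_integrable hg g0 hβ hβ1 (X := (s, x)) ⟨hs, hsT⟩,
      hK.ae_integrable hg g0 hβ hβ1 (X := (s, x')) ⟨hs, hsT⟩] with r hr hr'
    simp only [Pi.sub_apply, convIntegrand]
    rw [← integral_sub hr hr']
    simp only [← mul_sub]
    exact (enorm_integral_le_lintegral_enorm _).trans
      (lintegral_enorm_mul_sub_le_of_holderWith hg x x' _)
  · obtain ⟨t, hst, htT⟩ := EReal.lt_iff_exists_real_btwn.1 hsT
    exact hK.mass s t hs.le (by exact_mod_cast hst) htT.le

theorem KernelConditions.eLpNorm_convIntegrand_Ioc_le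
    (hK : KernelConditions K T β γ₁ γ₂ N₀ N₁) (hg : HolderWith Cg β g) (g0 : g 0 = 0)
    (hβ1 : β ≤ 1) {s t : ℝ} (hs : 0 ≤ s) (hst : s ≤ t) (htT : (t : EReal) ≤ T)
    {x : EuclideanSpace ℝ (Fin d)} (hx : ‖x‖ ≤ R) :
    eLpNorm (convIntegrand K g (t, x)) 2 (volume.restrict (Ioc s t)) ≤
      (Cg * (1 + R ^ (β : ℝ)) : ℝ≥0) *
        (N₁ * ENNReal.ofReal ((t - s) ^ γ₂)) ^ (1 / 2 : ℝ) := by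
  refine eLpNorm_two_le_of_ae_enorm_le (h := fun r => ∫⁻ z, ‖K (t - r) z‖ₑ *
    ENNReal.ofReal (1 + ‖z‖ ^ (β : ℝ))) (ae_of_all _ fun r => ?_) ?_
  · exact (enorm_integral_le_lintegral_enorm _).trans
      (lintegral_enorm_mul_le_of_holderWith hg g0 hβ1 hx _)
  · rcases hst.eq_or_lt with rfl | hlt
    · simp
    · exact hK.short_time s t hs hlt htT

theorem KernelConditions.memLp_convIntegrand (hK : KernelConditions K T β γ₁ γ₂ N₀ N₁)
    (hg : HolderWith Cg β g) (g0 : g 0 = 0) (hβ : 0 < β) (hβ1 : β ≤ 1) {X : SpaceTime d}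
    (hX : X ∈ timeStrip d T) : MemLp (convIntegrand K g X) 2 (volume.restrict (Ioc 0 X.1)) := by
  refine ⟨(stronglyMeasurable_convIntegrand hK.measurable (hg.continuous hβ).measurable
    X).aestronglyMeasurable, ?_⟩
  exact (hK.eLpNorm_convIntegrand_Ioc_le hg g0 hβ1 le_rfl hX.1.le hX.2.le
    (R := ‖X.2‖₊) le_rfl).trans_lt (by finiteness)

theorem KernelConditions.eLpNorm_convIntegrand_sub_le_add
    (hK : KernelConditions K T β γ₁ γ₂ N₀ N₁) (hg : HolderWith Cg β g) (g0 : g 0 = 0) (hβ : 0 < β)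
    (hβ1 : β ≤ 1) {X Y : SpaceTime d} (hX : X ∈ timeStrip d T) (hY : Y ∈ timeStrip d T)
    (hYX : Y.1 ≤ X.1) (hXR : ‖X.2‖ ≤ R) :
    eLpNorm (convIntegrand K g X - (Ioc 0 Y.1).indicator (convIntegrand K g Y)) 2
        (volume.restrict (Ioc 0 X.1)) ≤
      (Cg * (1 + R ^ (β : ℝ)) : ℝ≥0) * (N₁ * ENNReal.ofReal ((X.1 - Y.1) ^ γ₁)) ^ (1 / 2 : ℝ) +
      (Cg * nndist X.2 Y.2 ^ (β : ℝ) : ℝ≥0) * (N₀ : ℝ≥0∞) ^ (1 / 2 : ℝ) +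
      (Cg * (1 + R ^ (β : ℝ)) : ℝ≥0) *
        (N₁ * ENNReal.ofReal ((X.1 - Y.1) ^ γ₂)) ^ (1 / 2 : ℝ) := by
  have hmeas (Z : SpaceTime d) : StronglyMeasurable (convIntegrand K g Z) :=
    stronglyMeasurable_convIntegrand hK.measurable (hg.continuous hβ).measurable Z
  have hdiff : Ioc 0 X.1 \ Ioc 0 Y.1 = Ioc Y.1 X.1 := by
    rw [← Ioc_union_Ioc_eq_Ioc hY.1.le hYX, union_sdiff_cancel_left]
    exact (Ioc_disjoint_Ioc_of_le le_rfl).le_bot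
  calc _ ≤ eLpNorm (convIntegrand K g X - convIntegrand K g Y) 2 (volume.restrict (Ioc 0 Y.1)) +
        eLpNorm (convIntegrand K g X) 2 (volume.restrict (Ioc Y.1 X.1)) :=
      hdiff ▸ eLpNorm_sub_indicator_le one_le_two (hmeas X).aestronglyMeasurable
        (hmeas Y).aestronglyMeasurable measurableSet_Ioc (Ioc_subset_Ioc le_rfl hYX)
    _ ≤ eLpNorm (convIntegrand K g X - convIntegrand K g (Y.1, X.2)) 2
          (volume.restrict (Ioc 0 Y.1)) +
        eLpNorm (convIntegrand K g (Y.1, X.2) - convIntegrand K g Y) 2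
          (volume.restrict (Ioc 0 Y.1)) +
        eLpNorm (convIntegrand K g X) 2 (volume.restrict (Ioc Y.1 X.1)) := by
      rw [← sub_add_sub_cancel (convIntegrand K g X) (convIntegrand K g (Y.1, X.2))]
      gcongr
      exact eLpNorm_add_le ((hmeas _).sub (hmeas _)).aestronglyMeasurable
        ((hmeas _).sub (hmeas _)).aestronglyMeasurable one_le_two
    _ ≤ _ :=
      add_le_add (add_le_add
        (hK.eLpNorm_convIntegrand_time_sub_le hg g0 hβ hβ1 hY.1 hYX hX.2 hXR)
        (hK.eLpNorm_convIntegrand_space_sub_le hg g0 hβ hβ1 hY.1 hY.2 X.2 Y.2))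
        (hK.eLpNorm_convIntegrand_Ioc_le hg g0 hβ1 hY.1.le hYX hX.2.le hXR)

/-- The constant in the `L²` estimate for the increments of the deterministic convolution between
points with spatial norm at most `R`. -/
noncomputable def convolutionConst (N₀ N₁ Cg R β : ℝ≥0) : ℝ≥0 :=
  Cg * (1 + R ^ (β : ℝ)) * N₁ ^ (1 / 2 : ℝ) + Cg * N₀ ^ (1 / 2 : ℝ)

/-- The modulus of continuity of the convolution, as a function of the parabolic distance `δ`. -/
noncomputable def convolutionModulus (γ₁ γ₂ β : ℝ) (δ : ℝ≥0∞) : ℝ≥0∞ :=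
  δ ^ γ₁ + δ ^ γ₂ + δ ^ β

theorem KernelConditions.eLpNorm_convIntegrand_sub_le (hK : KernelConditions K T β γ₁ γ₂ N₀ N₁)
    (hg : HolderWith Cg β g) (g0 : g 0 = 0) (hβ : 0 < β) (hβ1 : β ≤ 1) (hγ₁ : 0 ≤ γ₁)
    (hγ₂ : 0 ≤ γ₂) {X Y : SpaceTime d} (hX : X ∈ timeStrip d T) (hY : Y ∈ timeStrip d T)
    (hYX : Y.1 ≤ X.1) (hXR : ‖X.2‖ ≤ R) :
    eLpNorm (convIntegrand K g X - (Ioc 0 Y.1).indicator (convIntegrand K g Y)) 2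
        (volume.restrict (Ioc 0 X.1)) ≤
      convolutionConst N₀ N₁ Cg R β *
        convolutionModulus γ₁ γ₂ β (ENNReal.ofReal (parabolicDist X Y)) := by
  refine (hK.eLpNorm_convIntegrand_sub_le_add hg g0 hβ hβ1 hX hY hYX hXR).trans ?_
  set δ := ENNReal.ofReal (parabolicDist X Y)
  set c : ℝ≥0 := Cg * (1 + R ^ (β : ℝ))
  have hspace : ((Cg * nndist X.2 Y.2 ^ (β : ℝ) : ℝ≥0) : ℝ≥0∞) ≤ Cg * δ ^ (β : ℝ) := by
    rw [ENNReal.coe_mul, ENNReal.coe_rpow_of_nonneg _ β.coe_nonneg, ← edist_nndist]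
    gcongr
    exact edist_snd_le_ofReal_parabolicDist X Y
  calc _ ≤ c * (N₁ ^ (1 / 2 : ℝ) * δ ^ γ₁) + Cg * δ ^ (β : ℝ) * N₀ ^ (1 / 2 : ℝ) +
        c * (N₁ ^ (1 / 2 : ℝ) * δ ^ γ₂) := by
        gcongr
        · exact mul_ofReal_sub_rpow_rpow_half_le hYX hγ₁ _
        · exact mul_ofReal_sub_rpow_rpow_half_le hYX hγ₂ _
    _ = (c * N₁ ^ (1 / 2 : ℝ) : ℝ≥0) * δ ^ γ₁ + (c * N₁ ^ (1 / 2 : ℝ) : ℝ≥0) * δ ^ γ₂ +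
        (Cg * N₀ ^ (1 / 2 : ℝ) : ℝ≥0) * δ ^ (β : ℝ) := by
      simp only [ENNReal.coe_mul, ENNReal.coe_rpow_of_nonneg _ one_half_pos.le]
      ring
    _ ≤ _ := by
      rw [convolutionModulus, mul_add, mul_add]
      gcongr
      · exact le_self_add
      · exact le_self_add
      · exact le_add_self

end Kernel

/-! ### The stochastic convolution -/

theorem stronglyMeasurable_indicator_of_continuousOn {α E : Type*} [TopologicalSpace α]
    [SecondCountableTopology α] [MeasurableSpace α] [OpensMeasurableSpace α] [TopologicalSpace E]
    [TopologicalSpace.PseudoMetrizableSpace E] [Zero E] {S : Set α} (hS : MeasurableSet S)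
    {F : α → E} (hF : ContinuousOn F S) : StronglyMeasurable (S.indicator F) := by
  refine stronglyMeasurable_of_restrict_of_restrict_compl hS ?_ ?_
  · convert (continuousOn_iff_continuous_domRestrict.1 hF).stronglyMeasurable using 1
    ext x
    exact indicator_of_mem x.2 F
  · convert stronglyMeasurable_const (b := (0 : E)) using 1
    ext x
    exact indicator_of_notMem x.2 F

theorem continuous_convolutionModulus (γ₁ γ₂ β : ℝ) :
    Continuous (convolutionModulus γ₁ γ₂ β) := by
  unfold convolutionModulus
  fun_prop

theorem convolutionModulus_le {γ₁ γ₂ β γ : ℝ} (hγ : 0 ≤ γ) (h₁ : γ ≤ γ₁) (h₂ : γ ≤ γ₂)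
    (hβ : γ ≤ β) {δ M : ℝ≥0∞} (hδ : δ ≤ M) :
    convolutionModulus γ₁ γ₂ β δ ≤ convolutionModulus (γ₁ - γ) (γ₂ - γ) (β - γ) M * δ ^ γ := by
  have hfactor {e : ℝ} (he : γ ≤ e) : δ ^ e ≤ M ^ (e - γ) * δ ^ γ := by
    calc δ ^ e = δ ^ (e - γ) * δ ^ γ := by
          rw [← ENNReal.rpow_add_of_nonneg _ _ (sub_nonneg.2 he) hγ, sub_add_cancel]
      _ ≤ M ^ (e - γ) * δ ^ γ := by gcongr
  rw [convolutionModulus, convolutionModulus, add_mul, add_mul]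
  exact add_le_add (add_le_add (hfactor h₁) (hfactor h₂)) (hfactor hβ)

section StochConvolution

variable {d : ℕ} {K : ℝ → EuclideanSpace ℝ (Fin d) → ℝ} {g : EuclideanSpace ℝ (Fin d) → ℝ}
  {T : EReal} {β : ℝ≥0} {γ₁ γ₂ : ℝ} {N₀ N₁ Cg R : ℝ≥0}
  {Ω : Type*} [MeasurableSpace Ω] {P : Measure Ω} {W : ℝ≥0 → Ω → ℝ}

theorem IsStochConvolutionOn.eLpNorm_sub_le {S : Set (SpaceTime d)} {u : SpaceTime d → Ω → ℝ}
    (hu : IsStochConvolutionOn P W K g S u) (hS : S ⊆ timeStrip d T)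
    (hK : KernelConditions K T β γ₁ γ₂ N₀ N₁) (hg : HolderWith Cg β g) (g0 : g 0 = 0) (hβ : 0 < β)
    (hβ1 : β ≤ 1) (hγ₁ : 0 ≤ γ₁) (hγ₂ : 0 ≤ γ₂) (hW : IsPreBrownianReal W P) {q : ℝ≥0∞}
    (hq : q ≠ ∞) {X Y : SpaceTime d} (hX : X ∈ S) (hY : Y ∈ S) (hXR : ‖X.2‖ ≤ R)
    (hYR : ‖Y.2‖ ≤ R) :
    eLpNorm (u X - u Y) q P ≤ stdNormalLpNorm q * (convolutionConst N₀ N₁ Cg R β *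
      convolutionModulus γ₁ γ₂ β (ENNReal.ofReal (parabolicDist X Y))) := by
  wlog hle : Y.1 ≤ X.1 generalizing X Y
  · rw [parabolicDist_comm, eLpNorm_sub_comm]
    exact this hY hX hYR hXR (le_of_not_ge hle)
  refine ((hu X hX).eLpNorm_sub_le (hu Y hY) (Real.toNNReal_le_toNNReal hle) hW hq).trans ?_
  rw [Real.coe_toNNReal _ (hS hY).1.le, Real.coe_toNNReal _ (hS hX).1.le]
  gcongr
  exact hK.eLpNorm_convIntegrand_sub_le hg g0 hβ hβ1 hγ₁ hγ₂ (hS hX) (hS hY) hle hXR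

/-- The Hölder constant in `L^q(Ω)`, with exponent `γ`, of the stochastic convolution on the ball
of radius `R` in space-time. -/
noncomputable def stochConvolutionHolderConst (q : ℝ≥0∞) (γ₁ γ₂ γ : ℝ) (N₀ N₁ Cg R β : ℝ≥0) :
    ℝ≥0∞ :=
  stdNormalLpNorm q * (convolutionConst N₀ N₁ Cg R β *
    convolutionModulus (γ₁ - γ) (γ₂ - γ) (β - γ)
      (ENNReal.ofReal (max (2 * R) ((2 * R) ^ (1 / 2 : ℝ)))))

theorem stochConvolutionHolderConst_ne_top {q : ℝ≥0∞} (hq : q ≠ ∞) {γ : ℝ} (h₁ : γ ≤ γ₁)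
    (h₂ : γ ≤ γ₂) (hβ : γ ≤ β) : stochConvolutionHolderConst q γ₁ γ₂ γ N₀ N₁ Cg R β ≠ ∞ := by
  have hfin {e : ℝ} (he : γ ≤ e) :
      ENNReal.ofReal (max (2 * R) ((2 * R) ^ (1 / 2 : ℝ))) ^ (e - γ) ≠ ∞ :=
    ENNReal.rpow_ne_top_of_nonneg (sub_nonneg.2 he) ENNReal.ofReal_ne_top
  exact ENNReal.mul_ne_top (stdNormalLpNorm_ne_top hq) (ENNReal.mul_ne_top ENNReal.coe_ne_top
    (ENNReal.add_ne_top.2 ⟨ENNReal.add_ne_top.2 ⟨hfin h₁, hfin h₂⟩, hfin hβ⟩))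

theorem IsStochConvolutionOn.eLpNorm_sub_le_rpow {D : Set (SpaceTime d)} {u : SpaceTime d → Ω → ℝ}
    (hu : IsStochConvolutionOn P W K g D u) (hDT : D ⊆ timeStrip d T)
    (hDR : D ⊆ Metric.closedBall 0 R) (hK : KernelConditions K T β γ₁ γ₂ N₀ N₁)
    (hg : HolderWith Cg β g) (g0 : g 0 = 0) (hβ : 0 < β) (hβ1 : β ≤ 1) {γ : ℝ} (hγ : 0 ≤ γ)
    (h₁ : γ ≤ γ₁) (h₂ : γ ≤ γ₂) (hγβ : γ ≤ β) (hW : IsPreBrownianReal W P) {q : ℝ≥0∞}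
    (hq : q ≠ ∞) {X Y : SpaceTime d} (hX : X ∈ D) (hY : Y ∈ D) :
    eLpNorm (u X - u Y) q P ≤ stochConvolutionHolderConst q γ₁ γ₂ γ N₀ N₁ Cg R β *
      ENNReal.ofReal (parabolicDist X Y) ^ γ := by
  have hnorm {Z : SpaceTime d} (hZ : Z ∈ D) : ‖Z.2‖ ≤ R :=
    (norm_snd_le Z).trans (mem_closedBall_zero_iff.1 (hDR hZ))
  refine (hu.eLpNorm_sub_le hDT hK hg g0 hβ hβ1 (hγ.trans h₁) (hγ.trans h₂) hW hq hX hY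
    (hnorm hX) (hnorm hY)).trans ?_
  rw [stochConvolutionHolderConst, mul_assoc, mul_assoc]
  gcongr
  exact convolutionModulus_le hγ h₁ h₂ hγβ
    (ENNReal.ofReal_le_ofReal (parabolicDist_le_of_mem_closedBall (hDR hX) (hDR hY)))

theorem IsStochConvolutionOn.continuousOn {S : Set (SpaceTime d)} {F : SpaceTime d → Lp ℝ 2 P}
    (hF : IsStochConvolutionOn P W K g S fun X => F X) (hS : S ⊆ timeStrip d T)
    (hK : KernelConditions K T β γ₁ γ₂ N₀ N₁) (hg : HolderWith Cg β g) (g0 : g 0 = 0) (hβ : 0 < β)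
    (hβ1 : β ≤ 1) (hγ₁ : 0 < γ₁) (hγ₂ : 0 < γ₂) (hW : IsPreBrownianReal W P) :
    ContinuousOn F S := by
  intro X hX
  rw [ContinuousWithinAt, tendsto_iff_edist_tendsto_0]
  have hdist : Tendsto (fun Y => ENNReal.ofReal (parabolicDist Y X)) (𝓝 X) (𝓝 0) := by
    have hcont : Continuous fun Y => parabolicDist Y X :=
      continuous_parabolicDist.comp (f := fun Y => (Y, X)) (by fun_prop)
    simpa [parabolicDist_self] using ENNReal.tendsto_ofReal (hcont.tendsto X)
  have hmod : Tendsto (fun Y => convolutionModulus γ₁ γ₂ β (ENNReal.ofReal (parabolicDist Y X)))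
      (𝓝[S] X) (𝓝 0) := by
    have h0 := (continuous_convolutionModulus γ₁ γ₂ β).tendsto 0
    rw [show convolutionModulus γ₁ γ₂ β 0 = 0 by simp [convolutionModulus, hγ₁, hγ₂, hβ]] at h0
    exact h0.comp (hdist.mono_left nhdsWithin_le_nhds)
  have hbound : Tendsto (fun Y => stdNormalLpNorm 2 * (convolutionConst N₀ N₁ Cg (‖X.2‖₊ + 1) β *
      convolutionModulus γ₁ γ₂ β (ENNReal.ofReal (parabolicDist Y X)))) (𝓝[S] X) (𝓝 0) := by
    simpa using ENNReal.Tendsto.const_mul (ENNReal.Tendsto.const_mul hmod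
      (Or.inr ENNReal.coe_ne_top)) (Or.inr (stdNormalLpNorm_ne_top (q := 2) (by simp)))
  have hnear : ∀ᶠ Y in 𝓝[S] X, ‖Y.2‖ < ‖X.2‖ + 1 := nhdsWithin_le_nhds
    ((continuous_snd.norm.tendsto X).eventually_lt_const (lt_add_one _))
  refine tendsto_of_tendsto_of_tendsto_of_le_of_le' tendsto_const_nhds hbound
    (Eventually.of_forall fun _ => zero_le) ?_
  filter_upwards [hnear, self_mem_nhdsWithin] with Y hYX hY
  rw [Lp.edist_def]
  exact hF.eLpNorm_sub_le hS hK hg g0 hβ hβ1 hγ₁.le hγ₂.le hW (by simp) hY hX hYX.le (by simp)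

theorem KernelConditions.exists_isStochConvolutionOn (hK : KernelConditions K T β γ₁ γ₂ N₀ N₁)
    (hg : HolderWith Cg β g) (g0 : g 0 = 0) (hβ : 0 < β) (hβ1 : β ≤ 1)
    (hW : IsPreBrownianReal W P) :
    ∃ F : SpaceTime d → Lp ℝ 2 P,
      IsStochConvolutionOn P W K g (timeStrip d T) fun X => F X := by
  have hex (X : SpaceTime d) (hX : X ∈ timeStrip d T) :
      ∃ J : Lp ℝ 2 P, IsWienerIntegral P W X.1.toNNReal (convIntegrand K g X) J := by
    refine exists_isWienerIntegral hW ?_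
    rw [Real.coe_toNNReal _ hX.1.le]
    exact hK.memLp_convIntegrand hg g0 hβ hβ1 hX
  choose! F hF using hex
  exact ⟨F, hF⟩

theorem KernelConditions.exists_measurable_isStochConvolutionOn
    (hK : KernelConditions K T β γ₁ γ₂ N₀ N₁) (hg : HolderWith Cg β g) (g0 : g 0 = 0) (hβ : 0 < β)
    (hβ1 : β ≤ 1) (hγ₁ : 0 < γ₁) (hγ₂ : 0 < γ₂) (hW : IsPreBrownianReal W P) :
    ∃ u : SpaceTime d → Ω → ℝ, Measurable (Function.uncurry u) ∧
      IsStochConvolutionOn P W K g (timeStrip d T) u := by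
  obtain ⟨F, hF⟩ := hK.exists_isStochConvolutionOn hg g0 hβ hβ1 hW
  have hstrip : IsOpen (timeStrip d T) := (isOpen_lt continuous_const continuous_fst).inter
    (isOpen_lt (continuous_coe_real_ereal.comp continuous_fst) continuous_const)
  have hFcont : ContinuousOn F (timeStrip d T) :=
    hF.continuousOn subset_rfl hK hg g0 hβ hβ1 hγ₁ hγ₂ hW
  obtain ⟨u, hum, hu⟩ := exists_measurable_version
    (stronglyMeasurable_indicator_of_continuousOn hstrip.measurableSet hFcont)
  refine ⟨u, hum, fun X hX => (hF X hX).congr_ae ?_⟩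
  simpa [indicator_of_mem hX] using (hu X).symm

end StochConvolution

/-! ### From Hölder continuity in `L^p` to the Campanato seminorm -/

section ParabolicBall

variable {d : ℕ}

theorem parabolicBall_eq_prod (X : SpaceTime d) {ρ : ℝ} (hρ : 0 < ρ) :
    parabolicBall X ρ = Metric.ball X.1 (ρ ^ 2) ×ˢ Metric.ball X.2 ρ := by
  ext Y
  rw [parabolicBall, mem_ofPred_eq, parabolicDist, max_lt_iff, ← Real.sqrt_eq_rpow,
    Real.sqrt_lt' hρ, mem_prod, Metric.mem_ball', Metric.mem_ball', Real.dist_eq, dist_eq_norm,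
    and_comm]

theorem isOpen_parabolicBall (X : SpaceTime d) (ρ : ℝ) : IsOpen (parabolicBall X ρ) :=
  isOpen_lt (continuous_parabolicDist.comp (f := fun Y => (X, Y)) (by fun_prop)) continuous_const

theorem volume_parabolicBall_eq_mul (X : SpaceTime d) {ρ : ℝ} (hρ : 0 < ρ) :
    volume (parabolicBall X ρ) = ENNReal.ofReal ρ ^ ((d : ℝ) + 2) *
      (2 * volume (Metric.ball (0 : EuclideanSpace ℝ (Fin d)) 1)) := by
  rw [parabolicBall_eq_prod X hρ, Measure.volume_eq_prod, Measure.prod_prod, Real.volume_ball,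
    Measure.addHaar_ball_of_pos _ _ hρ, finrank_euclideanSpace, Fintype.card_fin,
    ENNReal.ofReal_mul (by norm_num), ENNReal.ofReal_pow hρ.le, ENNReal.ofReal_pow hρ.le,
    ENNReal.rpow_add _ _ (by simpa using hρ) (by simp)]
  simp only [ENNReal.rpow_natCast, ENNReal.rpow_ofNat, ENNReal.ofReal_ofNat]
  ring

theorem volume_parabolicBall (X : SpaceTime d) {ρ : ℝ} (hρ : 0 < ρ) :
    volume (parabolicBall X ρ) =
      ENNReal.ofReal ρ ^ ((d : ℝ) + 2) * volume (parabolicBall (0 : SpaceTime d) 1) := by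
  simp [volume_parabolicBall_eq_mul X hρ, volume_parabolicBall_eq_mul 0 one_pos]

theorem volume_parabolicBall_ne_zero (X : SpaceTime d) {ρ : ℝ} (hρ : 0 < ρ) :
    volume (parabolicBall X ρ) ≠ 0 :=
  (isOpen_parabolicBall X ρ).measure_ne_zero volume
    ⟨X, by simpa [parabolicBall, parabolicDist_self] using hρ⟩

theorem volume_parabolicBall_ne_top (X : SpaceTime d) {ρ : ℝ} (hρ : 0 < ρ) :
    volume (parabolicBall X ρ) ≠ ∞ := by
  rw [volume_parabolicBall_eq_mul X hρ]
  exact ENNReal.mul_ne_top (by finiteness) (ENNReal.mul_ne_top (by simp) measure_ball_lt_top.ne)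

theorem parabolicDist_lt_two_mul {X Y Z : SpaceTime d} {ρ : ℝ} (hY : Y ∈ parabolicBall X ρ)
    (hZ : Z ∈ parabolicBall X ρ) : parabolicDist Y Z < 2 * ρ := by
  have hYX : parabolicDist Y X < ρ := parabolicDist_comm Y X ▸ hY
  have hXZ : parabolicDist X Z < ρ := hZ
  linarith [parabolicDist_triangle Y X Z]

end ParabolicBall

section Campanato

variable {d : ℕ} {Ω : Type*} [MeasurableSpace Ω] {P : Measure Ω}

theorem expectedOscillation_le [SFinite P] {p : ℝ} (hp : 0 < p) {Q : Set (SpaceTime d)}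
    (hQ : MeasurableSet Q) {u : SpaceTime d → Ω → ℝ} (hu : Measurable (Function.uncurry u))
    {B : ℝ≥0∞} (hB : ∀ Y ∈ Q, ∀ Z ∈ Q, eLpNorm (u Y - u Z) (ENNReal.ofReal p) P ≤ B) :
    expectedOscillation P p Q u ≤ B ^ p * volume Q ^ 2 := by
  have hmoment (Y) (hY : Y ∈ Q) (Z) (hZ : Z ∈ Q) : ∫⁻ ω, ‖u Y ω - u Z ω‖ₑ ^ p ∂P ≤ B ^ p := by
    have h := hB Y hY Z hZ
    rw [eLpNorm_eq_lintegral_rpow_enorm_toReal (by simpa using hp) (by simp),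
      ENNReal.toReal_ofReal hp.le, one_div, ENNReal.rpow_inv_le_iff hp] at h
    exact h
  have hmeas : Measurable fun q : (Ω × SpaceTime d) × SpaceTime d =>
      ‖u q.1.2 q.1.1 - u q.2 q.1.1‖ₑ ^ p := by
    refine (Measurable.enorm (Measurable.sub ?_ ?_)).pow_const p
    · exact hu.comp (by fun_prop : Measurable fun q : (Ω × SpaceTime d) × SpaceTime d =>
        (q.1.2, q.1.1))
    · exact hu.comp (by fun_prop : Measurable fun q : (Ω × SpaceTime d) × SpaceTime d =>
        (q.2, q.1.1))
  have hswap (Y) : ∫⁻ ω, ∫⁻ Z in Q, ‖u Y ω - u Z ω‖ₑ ^ p ∂volume ∂P =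
      ∫⁻ Z in Q, ∫⁻ ω, ‖u Y ω - u Z ω‖ₑ ^ p ∂P ∂volume :=
    lintegral_lintegral_swap (hmeas.comp ((measurable_fst.prodMk measurable_const).prodMk
      measurable_snd)).aemeasurable
  calc expectedOscillation P p Q u
      = ∫⁻ Y in Q, ∫⁻ Z in Q, ∫⁻ ω, ‖u Y ω - u Z ω‖ₑ ^ p ∂P := by
        rw [expectedOscillation,
          lintegral_lintegral_swap (Measurable.lintegral_prod_right' hmeas).aemeasurable]
        simp_rw [hswap]
    _ ≤ ∫⁻ _ in Q, ∫⁻ _ in Q, B ^ p :=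
        setLIntegral_mono' hQ fun Y hY => setLIntegral_mono' hQ fun Z hZ => hmoment Y hY Z hZ
    _ = B ^ p * volume Q ^ 2 := by simp [sq, mul_assoc]

theorem rpow_le_div_of_rpow_mul_le {r a m : ℝ≥0∞} {k γ : ℝ} (hk : 0 < k) (hγ : 0 ≤ γ)
    (ha0 : a ≠ 0) (ha : a ≠ ∞) (h : r ^ k * a ≤ m) : r ^ γ ≤ m ^ (γ / k) / a ^ (γ / k) := by
  calc r ^ γ = (r ^ k) ^ (γ / k) := by rw [← ENNReal.rpow_mul, mul_div_cancel₀ _ hk.ne']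
    _ ≤ (m / a) ^ (γ / k) := by
        gcongr
        exact (ENNReal.le_div_iff_mul_le (.inl ha0) (.inl ha)).2 h
    _ = m ^ (γ / k) / a ^ (γ / k) := ENNReal.div_rpow_of_nonneg _ _ (by positivity)

theorem mul_rpow_rpow_mul_sq {L m : ℝ≥0∞} (hm0 : m ≠ 0) (hm : m ≠ ∞) {p : ℝ} (hp : 0 ≤ p)
    (e : ℝ) : (L * m ^ e) ^ p * m ^ 2 = L ^ p * m ^ (1 + (1 + e * p)) := by
  rw [ENNReal.mul_rpow_of_nonneg _ _ hp, ← ENNReal.rpow_mul, mul_assoc, ← ENNReal.rpow_natCast,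
    ← ENNReal.rpow_add _ _ hm0 hm]
  congr 2
  push_cast
  ring

theorem expectedOscillation_div_le_of_eLpNorm_sub_le [SFinite P] {Q : Set (SpaceTime d)}
    (hQ : MeasurableSet Q) {X : SpaceTime d} {ρ : ℝ} (hρ : 0 < ρ) (hQρ : Q ⊆ parabolicBall X ρ)
    {a : ℝ≥0∞} {k : ℝ} (hk : 0 < k) (ha0 : a ≠ 0) (ha : a ≠ ∞)
    (hlow : ENNReal.ofReal ρ ^ k * a ≤ volume Q) {p γ : ℝ} (hp : 0 < p) (hγ : 0 ≤ γ)
    {u : SpaceTime d → Ω → ℝ} (hum : Measurable (Function.uncurry u)) {B : ℝ≥0∞}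
    (hu : ∀ Y ∈ Q, ∀ Z ∈ Q, eLpNorm (u Y - u Z) (ENNReal.ofReal p) P ≤
      B * ENNReal.ofReal (parabolicDist Y Z) ^ γ) :
    expectedOscillation P p Q u / volume Q ^ (1 + (1 + γ * p / k)) ≤
      (B * 2 ^ γ / a ^ (γ / k)) ^ p := by
  have hQ0 : volume Q ≠ 0 := by
    refine ne_of_gt (lt_of_lt_of_le (pos_iff_ne_zero.2 (mul_ne_zero ?_ ha0)) hlow)
    simp [ENNReal.rpow_eq_zero_iff, hρ]
  have hQtop : volume Q ≠ ∞ :=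
    ne_top_of_le_ne_top (volume_parabolicBall_ne_top X hρ) (measure_mono hQρ)
  have hincr (Y) (hY : Y ∈ Q) (Z) (hZ : Z ∈ Q) : eLpNorm (u Y - u Z) (ENNReal.ofReal p) P ≤
      B * 2 ^ γ / a ^ (γ / k) * volume Q ^ (γ / k) := by
    calc eLpNorm (u Y - u Z) (ENNReal.ofReal p) P
        ≤ B * ENNReal.ofReal (parabolicDist Y Z) ^ γ := hu Y hY Z hZ
      _ ≤ B * (2 ^ γ * ENNReal.ofReal ρ ^ γ) := by
          rw [← ENNReal.mul_rpow_of_nonneg _ _ hγ, ← ENNReal.ofReal_ofNat,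
            ← ENNReal.ofReal_mul zero_le_two]
          gcongr
          exact (parabolicDist_lt_two_mul (hQρ hY) (hQρ hZ)).le
      _ ≤ B * (2 ^ γ * (volume Q ^ (γ / k) / a ^ (γ / k))) := by
          gcongr
          exact rpow_le_div_of_rpow_mul_le hk hγ ha0 ha hlow
      _ = B * 2 ^ γ / a ^ (γ / k) * volume Q ^ (γ / k) := by
          simp only [div_eq_mul_inv]
          ring
  refine ENNReal.div_le_of_le_mul ((expectedOscillation_le hp hQ hum hincr).trans_eq ?_)
  rw [mul_rpow_rpow_mul_sq hQ0 hQtop hp.le, div_mul_eq_mul_div]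

theorem mul_volume_parabolicBall_ne_zero {A : ℝ≥0} (hA : 0 < A) :
    A * volume (parabolicBall (0 : SpaceTime d) 1) ≠ 0 :=
  mul_ne_zero (by exact_mod_cast hA.ne') (volume_parabolicBall_ne_zero 0 one_pos)

theorem mul_volume_parabolicBall_ne_top (A : ℝ≥0) :
    A * volume (parabolicBall (0 : SpaceTime d) 1) ≠ ∞ :=
  ENNReal.mul_ne_top ENNReal.coe_ne_top (volume_parabolicBall_ne_top 0 one_pos)

theorem stochCampanatoSeminorm_le_of_eLpNorm_sub_le [SFinite P] {D : Set (SpaceTime d)}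
    (hD : MeasurableSet D) {A : ℝ≥0} (hA : 0 < A) (hDA : IsATypeWith A D) {p γ : ℝ} (hp : 0 < p)
    (hγ : 0 ≤ γ) {u : SpaceTime d → Ω → ℝ} (hum : Measurable (Function.uncurry u)) {B : ℝ≥0∞}
    (hu : ∀ Y ∈ D, ∀ Z ∈ D, eLpNorm (u Y - u Z) (ENNReal.ofReal p) P ≤
      B * ENNReal.ofReal (parabolicDist Y Z) ^ γ) :
    stochCampanatoSeminorm P p (1 + γ * p / ((d : ℝ) + 2)) D u ≤
      B * 2 ^ γ / (A * volume (parabolicBall (0 : SpaceTime d) 1)) ^ (γ / ((d : ℝ) + 2)) := by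
  rw [stochCampanatoSeminorm, one_div, ENNReal.rpow_inv_le_iff hp]
  refine iSup₂_le fun X hX => iSup₂_le fun ρ hρ => ?_
  refine expectedOscillation_div_le_of_eLpNorm_sub_le
    (hD.inter (isOpen_parabolicBall X ρ).measurableSet) hρ.1 inter_subset_right (by positivity)
    (mul_volume_parabolicBall_ne_zero hA) (mul_volume_parabolicBall_ne_top A) ?_ hp hγ hum
    fun Y hY Z hZ => hu Y hY.1 Z hZ.1
  rw [mul_left_comm, ← volume_parabolicBall X hρ.1]
  exact hDA X hX ρ hρ.1 hρ.2

end Campanato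

theorem theorem2p2_general (d : ℕ) (T : EReal) (p : ℝ) (hp : 0 < p)
    (β : ℝ≥0) (hβ : 0 < β) (hβ1 : β ≤ 1) (γ₁ γ₂ : ℝ) (hγ₁ : 0 < γ₁) (hγ₂ : 0 < γ₂)
    (N₀ N₁ Cg A R : ℝ≥0) (hA : 0 < A) :
    ∃ N : ℝ≥0,
      ∀ (K : ℝ → EuclideanSpace ℝ (Fin d) → ℝ), KernelConditions K T β γ₁ γ₂ N₀ N₁ →
      ∀ (g : EuclideanSpace ℝ (Fin d) → ℝ), HolderWith Cg β g → g 0 = 0 →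
      ∀ (Ω : Type*) [MeasurableSpace Ω] (P : Measure Ω) (W : ℝ≥0 → Ω → ℝ), IsPreBrownianReal W P →
      (∃ u : SpaceTime d → Ω → ℝ, Measurable (Function.uncurry u) ∧
        IsStochConvolutionOn P W K g (timeStrip d T) u) ∧
      ∀ (D : Set (SpaceTime d)), MeasurableSet D → D ⊆ timeStrip d T →
        D ⊆ Metric.closedBall 0 R → IsATypeWith A D →
      ∀ u : SpaceTime d → Ω → ℝ, Measurable (Function.uncurry u) →
        IsStochConvolutionOn P W K g D u →
        stochCampanatoSeminorm P p (1 + min (min γ₁ γ₂) (β : ℝ) * p / ((d : ℝ) + 2)) D u ≤ N := by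
  set γ := min (min γ₁ γ₂) (β : ℝ)
  have hγ : 0 ≤ γ := (lt_min (lt_min hγ₁ hγ₂) hβ).le
  have h₁ : γ ≤ γ₁ := (min_le_left _ _).trans (min_le_left _ _)
  have h₂ : γ ≤ γ₂ := (min_le_left _ _).trans (min_le_right _ _)
  have hγβ : γ ≤ β := min_le_right _ _
  have hfinite : stochConvolutionHolderConst (ENNReal.ofReal p) γ₁ γ₂ γ N₀ N₁ Cg R β * 2 ^ γ /
      (A * volume (parabolicBall (0 : SpaceTime d) 1)) ^ (γ / ((d : ℝ) + 2)) ≠ ∞ :=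
    ENNReal.div_ne_top (ENNReal.mul_ne_top
      (stochConvolutionHolderConst_ne_top ENNReal.ofReal_ne_top h₁ h₂ hγβ) (by finiteness))
      (ENNReal.rpow_pos (pos_iff_ne_zero.2 (mul_volume_parabolicBall_ne_zero hA))
        (mul_volume_parabolicBall_ne_top A)).ne'
  obtain ⟨N, hN⟩ := WithTop.ne_top_iff_exists.1 hfinite
  refine ⟨N, fun K hK g hg g0 Ω _ P W hW =>
    ⟨hK.exists_measurable_isStochConvolutionOn hg g0 hβ hβ1 hγ₁ hγ₂ hW,
      fun D hD hDT hDR hDA u hum hu => ?_⟩⟩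
  have := hW.isGaussianProcess.isProbabilityMeasure
  refine (stochCampanatoSeminorm_le_of_eLpNorm_sub_le hD hA hDA hp hγ hum
    fun Y hY Z hZ => ?_).trans_eq hN.symm
  exact hu.eLpNorm_sub_le_rpow hDT hDR hK hg g0 hβ hβ1 hγ h₁ h₂ hγβ hW ENNReal.ofReal_ne_top hY hZ

theorem theorem2p2 (d : ℕ) (T : EReal) (hT : 0 < T) (p : ℝ) (hp : 1 ≤ p)
    (β : ℝ≥0) (hβ : 0 < β) (hβ1 : β < 1) (γ₁ γ₂ : ℝ) (hγ₁ : 0 < γ₁) (hγ₂ : 0 < γ₂)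
    (N₀ N₁ Cg A R : ℝ≥0) (hA : 0 < A) :
    ∃ N : ℝ≥0,
      ∀ (K : ℝ → EuclideanSpace ℝ (Fin d) → ℝ), KernelConditions K T β γ₁ γ₂ N₀ N₁ →
      ∀ (g : EuclideanSpace ℝ (Fin d) → ℝ), HolderWith Cg β g → g 0 = 0 →
      ∀ (Ω : Type*) [MeasurableSpace Ω] (P : Measure Ω) [IsProbabilityMeasure P]
        (W : ℝ≥0 → Ω → ℝ), IsBrownianReal W P →
      (∃ u : SpaceTime d → Ω → ℝ, Measurable (Function.uncurry u) ∧
        IsStochConvolutionOn P W K g (timeStrip d T) u) ∧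
      ∀ (D : Set (SpaceTime d)), IsOpen D → IsConnected D →
        closure D ⊆ timeStrip d T → D ⊆ Metric.closedBall 0 R → IsATypeWith A D →
      ∀ u : SpaceTime d → Ω → ℝ, Measurable (Function.uncurry u) →
        IsStochConvolutionOn P W K g D u →
        stochCampanatoSeminorm P p (1 + min (min γ₁ γ₂) (β : ℝ) * p / ((d : ℝ) + 2)) D u ≤ N := by
  obtain ⟨N, hN⟩ := theorem2p2_general d T p (zero_lt_one.trans_le hp) β hβ hβ1.le γ₁ γ₂ hγ₁ hγ₂
    N₀ N₁ Cg A R hA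
  refine ⟨N, fun K hK g hg g0 Ω _ P _ W hW => ?_⟩
  obtain ⟨hex, hle⟩ := hN K hK g hg g0 Ω P W hW.toIsPreBrownianReal
  exact ⟨hex, fun D hDo _ hDT => hle D hDo.measurableSet (subset_closure.trans hDT)⟩
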